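/- Let $\mathbb K=\mathbb R$ or $\mathbb C$, let $d\ge 2$, and let $$\mathbb X=\{p\in \mathrm{Herm}(d,\mathbb K): p \text{ positive definite},\ \det p=1\}$$ be the symmetric space of $\mathrm{SL}(d,\mathbb K)$, with the action $g\cdot p=gpg^\dagger$ and the Riemannian metric $\langle V,W\rangle_p=\tfrac12\operatorname{Tr}(p^{-1}Vp^{-1}W)$. Its visual boundary $\partial\mathbb X$ is the set of unit-speed geodesic rays modulo bounded distance. Let $Z=\frac1{\sqrt{2d(d-1)}}\operatorname{diag}(d-1,-1,\dots,-1)$ and let $c_{\pm Z}(t)=\exp(\pm tZ)\cdot I_d$. A line $\tau_+=g\,\mathbb K e_1$ in $\mathbb K^d$ (a point of $\mathbb{KP}^{d-1}$), with $g\in \mathrm{SL}(d,\mathbb K)$, is identified with the ideal point $g[c_Z]\in\partial\mathbb X$, and a hyperplane $\tau_-=h\,\langle e_2,\dots,e_d\rangle$ (a point of $(\mathbb{KP}^{d-1})^*$), with $h\in \mathrm{SL}(d,\mathbb K)$, with the ideal point $h[c_{-Z}]$. For $q\in\mathbb X$ let $\angle_q(\tau_-,\tau_+)$ be the Riemannian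 angle at $q$ between the geodesic rays from $q$ to these two ideal points. The line and the hyperplane are called transverse if $\tau_++\tau_-=\mathbb K^d$. **Lemma (Detecting transversality).** Let $\tau_+\in\mathbb{KP}^{d-1}$ and $\tau_-\in(\mathbb{KP}^{d-1})^*$. For every $q\in\mathbb X$, $\tau_+$ is transverse to $\tau_-$ if and only if $$\cos\angle_q(\tau_-,\tau_+)<\frac1{d-1}.$$ In particular, this inequality holds at some point $q\in\mathbb X$ if and only if it holds at every point $q\in\mathbb X$. -/

import Mathlib

open scoped Matrix ComplexOrder ContDiff LinearAlgebra.Projectivization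

noncomputable section

namespace SLSym

/-! ### The symmetric space of `SL(d, 𝕜)` -/

/-- Square matrices of size `d` with entries in `𝕜`. -/
abbrev Mat (d : ℕ) (𝕜 : Type*) : Type _ := Matrix (Fin d) (Fin d) 𝕜

/-- The group `SL(d, 𝕜)`. -/
abbrev SL (d : ℕ) (𝕜 : Type*) [RCLike 𝕜] : Type _ := Matrix.SpecialLinearGroup (Fin d) 𝕜

/-- The symmetric space of `SL(d, 𝕜)`: positive definite Hermitian matrices of determinant one. -/
@[ext] structure X (d : ℕ) (𝕜 : Type*) [RCLike 𝕜] where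
  val : Mat d 𝕜
  posDef : val.PosDef
  det_eq_one : val.det = 1

variable {d : ℕ} {𝕜 : Type*} [RCLike 𝕜]

theorem X.isUnit_det (p : X d 𝕜) : IsUnit p.1.det := by
  rw [p.det_eq_one]; exact isUnit_one

/-- `g • p = g p g†`. -/
instance : MulAction (SL d 𝕜) (X d 𝕜) where
  smul g p :=
    { val := g.1 * p.1 * g.1ᴴ
      posDef := p.posDef.mul_mul_conjTranspose_same (Matrix.vecMul_injective_of_isUnit
        ((Matrix.isUnit_iff_isUnit_det _).2 (by rw [g.2]; exact isUnit_one)))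
      det_eq_one := by
        rw [Matrix.det_mul, Matrix.det_mul, Matrix.det_conjTranspose, g.2, p.det_eq_one]; simp }
  one_smul p := X.ext (show (1 : SL d 𝕜).1 * p.1 * (1 : SL d 𝕜).1ᴴ = p.1 by simp)
  mul_smul g h p := X.ext
    (show (g * h).1 * p.1 * (g * h).1ᴴ = g.1 * (h.1 * p.1 * h.1ᴴ) * g.1ᴴ by
      simp [Matrix.conjTranspose_mul, Matrix.mul_assoc])

theorem smul_val (g : SL d 𝕜) (p : X d 𝕜) : (g • p).1 = g.1 * p.1 * g.1ᴴ := rfl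

/-- The base point `I_d`. -/
def basePoint (d : ℕ) (𝕜 : Type*) [RCLike 𝕜] : X d 𝕜 := ⟨1, Matrix.PosDef.one, Matrix.det_one⟩

/-! ### The Riemannian metric, lengths, distance -/

/-- The Riemannian metric `⟨V, W⟩_p = ½ Tr(p⁻¹ V p⁻¹ W)`. For `V`, `W` in
`T_p X = {V Hermitian : Tr(p⁻¹ V) = 0}` the trace is a real number. -/
def metric (p : X d 𝕜) (V W : Mat d 𝕜) : ℝ :=
  (1 / 2) * RCLike.re (p.1⁻¹ * V * p.1⁻¹ * W).trace

/-- The Riemannian norm of a tangent vector. -/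
def tnorm (p : X d 𝕜) (V : Mat d 𝕜) : ℝ := Real.sqrt (metric p V V)

/-- Curves in `X` of class `C^n`, as curves of matrices. -/
def IsCurve (n : WithTop ℕ∞) (γ : ℝ → X d 𝕜) : Prop :=
  ∀ i j, ContDiff ℝ n (fun t => (γ t).1 i j)

/-- The entrywise derivative of a curve of matrices. -/
def mderiv (W : ℝ → Mat d 𝕜) (t : ℝ) : Mat d 𝕜 :=
  Matrix.of fun i j => deriv (fun s => W s i j) t

/-- The velocity `γ'(t)` of a curve in `X`. -/
def velocity (γ : ℝ → X d 𝕜) (t : ℝ) : Mat d 𝕜 := mderiv (fun s => (γ s).1) t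

/-- The Riemannian length of the restriction of a curve to `[a, b]`. -/
def length (γ : ℝ → X d 𝕜) (a b : ℝ) : ℝ := ∫ t in a..b, tnorm (γ t) (velocity γ t)

/-- The Riemannian distance: the infimum of the lengths of the `C¹` curves from `p` to `q`. -/
def rdist (p q : X d 𝕜) : ENNReal :=
  ⨅ (γ : ℝ → X d 𝕜) (_ : IsCurve 1 γ ∧ γ 0 = p ∧ γ 1 = q), ENNReal.ofReal (length γ 0 1)


/-! Calculus of matrix-valued curves, entry by entry. -/

/-- `W` has entrywise derivative `W'` at `t`. -/
def HasMDerivAt (W : ℝ → Mat d 𝕜) (W' : Mat d 𝕜) (t : ℝ) : Prop :=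
  ∀ i j, HasDerivAt (fun s => W s i j) (W' i j) t

theorem HasMDerivAt.mderiv {W : ℝ → Mat d 𝕜} {W' : Mat d 𝕜} {t : ℝ} (h : HasMDerivAt W W' t) :
    mderiv W t = W' := by
  ext i j; exact (h i j).deriv

theorem HasMDerivAt.const (A : Mat d 𝕜) (t : ℝ) : HasMDerivAt (fun _ => A) 0 t :=
  fun i j => hasDerivAt_const t (A i j)

theorem HasMDerivAt.mul {V W : ℝ → Mat d 𝕜} {V' W' : Mat d 𝕜} {t : ℝ}
    (hV : HasMDerivAt V V' t) (hW : HasMDerivAt W W' t) :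
    HasMDerivAt (fun s => V s * W s) (V' * W t + V t * W') t := by
  intro i j
  simp only [Matrix.mul_apply, Matrix.add_apply, ← Finset.sum_add_distrib]
  exact HasDerivAt.fun_sum fun k _ => (hV i k).mul (hW k j)

theorem HasMDerivAt.const_mul_mul {W : ℝ → Mat d 𝕜} {W' : Mat d 𝕜} {t : ℝ}
    (h : HasMDerivAt W W' t) (A B : Mat d 𝕜) :
    HasMDerivAt (fun s => A * W s * B) (A * W' * B) t := by
  simpa using ((HasMDerivAt.const A t).mul h).mul (HasMDerivAt.const B t)

theorem IsCurve.hasMDerivAt {n : WithTop ℕ∞} (hn : n ≠ 0) {γ : ℝ → X d 𝕜} (h : IsCurve n γ)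
    (t : ℝ) : HasMDerivAt (fun s => (γ s).1) (velocity γ t) t :=
  fun i j => ((h i j).differentiable hn t).hasDerivAt

theorem X.inv_eq_adjugate (p : X d 𝕜) : p.1⁻¹ = p.1.adjugate := by
  rw [Matrix.inv_def, p.det_eq_one]; simp

theorem contDiff_det {n : WithTop ℕ∞} {W : ℝ → Mat d 𝕜}
    (h : ∀ i j, ContDiff ℝ n (fun t => W t i j)) : ContDiff ℝ n (fun t => (W t).det) := by
  simp only [Matrix.det_apply]
  exact ContDiff.sum fun σ _ => (contDiff_prod fun i _ => h _ _).const_smul _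

theorem IsCurve.contDiff_inv {n : WithTop ℕ∞} {γ : ℝ → X d 𝕜} (h : IsCurve n γ) (i j : Fin d) :
    ContDiff ℝ n (fun t => (γ t).1⁻¹ i j) := by
  simp only [X.inv_eq_adjugate, Matrix.adjugate_apply]
  refine contDiff_det fun k l => ?_
  by_cases hk : k = j
  · simp only [Matrix.updateRow_apply, hk, if_true]; exact contDiff_const
  · simpa only [Matrix.updateRow_apply, hk, if_false] using h k l

theorem IsCurve.hasMDerivAt_inv {n : WithTop ℕ∞} (hn : n ≠ 0) {γ : ℝ → X d 𝕜} (h : IsCurve n γ)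
    (t : ℝ) : HasMDerivAt (fun s => (γ s).1⁻¹)
      (-((γ t).1⁻¹ * velocity γ t * (γ t).1⁻¹)) t := by
  have h1 : HasMDerivAt (fun s => (γ s).1⁻¹) (SLSym.mderiv (fun s => (γ s).1⁻¹) t) t :=
    fun i j => ((h.contDiff_inv i j).differentiable hn t).hasDerivAt
  have h2 := (h1.mul (h.hasMDerivAt hn t)).mderiv
  have h3 : (fun s => (γ s).1⁻¹ * (γ s).1) = fun _ => (1 : Mat d 𝕜) := by
    funext s; exact Matrix.nonsing_inv_mul _ (γ s).isUnit_det
  rw [h3, (HasMDerivAt.const 1 t).mderiv] at h2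
  have h4 : SLSym.mderiv (fun s => (γ s).1⁻¹) t = -((γ t).1⁻¹ * velocity γ t * (γ t).1⁻¹) := by
    have h5 := congrArg (· * (γ t).1⁻¹) h2
    simp only [zero_mul, add_mul, Matrix.mul_assoc,
      Matrix.mul_nonsing_inv _ (γ t).isUnit_det, mul_one] at h5
    rw [Matrix.mul_assoc]
    exact eq_neg_of_add_eq_zero_left h5.symm
  rwa [h4] at h1

theorem IsCurve.continuous_speed {γ : ℝ → X d 𝕜} (h : IsCurve 1 γ) :
    Continuous fun t => tnorm (γ t) (velocity γ t) := by
  have hv : Continuous fun t => velocity γ t := by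
    refine continuous_pi fun i => continuous_pi fun j => ?_
    exact (h i j).continuous_deriv le_rfl
  have hi : Continuous fun t => (γ t).1⁻¹ :=
    continuous_pi fun i => continuous_pi fun j => (h.contDiff_inv i j).continuous
  unfold tnorm metric
  refine Real.continuous_sqrt.comp (continuous_const.mul (RCLike.continuous_re.comp ?_))
  exact (((hi.matrix_mul hv).matrix_mul hi).matrix_mul hv).matrix_trace

/-! `rdist` is a pseudo-distance. -/

theorem tnorm_smul (p : X d 𝕜) (r : ℝ) (V : Mat d 𝕜) : tnorm p (r • V) = |r| * tnorm p V := by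
  have : metric p (r • V) (r • V) = r ^ 2 * metric p V V := by
    simp only [metric, Matrix.mul_smul, Matrix.smul_mul, smul_smul, Matrix.trace_smul,
      RCLike.smul_re]
    ring
  rw [tnorm, tnorm, this, Real.sqrt_mul (sq_nonneg r), Real.sqrt_sq_eq_abs]

theorem velocity_comp {γ : ℝ → X d 𝕜} (h : IsCurve 1 γ) {σ : ℝ → ℝ} {σ' t : ℝ}
    (hσ : HasDerivAt σ σ' t) : velocity (fun s => γ (σ s)) t = σ' • velocity γ (σ t) := by
  refine HasMDerivAt.mderiv fun i j => ?_
  exact (h.hasMDerivAt one_ne_zero (σ t) i j).scomp t hσ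

theorem IsCurve.comp {n : WithTop ℕ∞} {γ : ℝ → X d 𝕜} (h : IsCurve n γ) {σ : ℝ → ℝ}
    (hσ : ContDiff ℝ n σ) : IsCurve n (fun s => γ (σ s)) :=
  fun i j => (h i j).comp hσ

/-- Length is invariant under monotone reparametrization. -/
theorem length_comp {γ : ℝ → X d 𝕜} (h : IsCurve 1 γ) {σ : ℝ → ℝ} (hσ : ContDiff ℝ 1 σ)
    (hm : Monotone σ) (a b : ℝ) : length (fun s => γ (σ s)) a b = length γ (σ a) (σ b) := by
  have hd : ∀ t, HasDerivAt σ (deriv σ t) t := fun t =>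
    (hσ.differentiable one_ne_zero t).hasDerivAt
  have := intervalIntegral.integral_comp_mul_deriv (a := a) (b := b) (fun t _ => hd t)
    (hσ.continuous_deriv le_rfl).continuousOn h.continuous_speed
  rw [length, length, ← this]
  refine intervalIntegral.integral_congr fun t _ => ?_
  simp only [velocity_comp h (hd t), tnorm_smul, Function.comp]
  rw [abs_of_nonneg (hm.deriv_nonneg), mul_comm]

theorem length_reverse {γ : ℝ → X d 𝕜} (h : IsCurve 1 γ) :
    length (fun s => γ (1 - s)) 0 1 = length γ 0 1 := by
  have hd : ∀ t, HasDerivAt (fun s : ℝ => 1 - s) (-1) t := fun t =>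
    (hasDerivAt_id t).const_sub 1
  have h1 : ∀ t, tnorm (γ (1 - t)) (velocity (fun s => γ (1 - s)) t)
      = tnorm (γ (1 - t)) (velocity γ (1 - t)) := fun t => by
    rw [velocity_comp h (hd t), tnorm_smul]; simp
  simp only [length, h1]
  rw [intervalIntegral.integral_comp_sub_left (fun t => tnorm (γ t) (velocity γ t)) 1]
  simp

theorem length_nonneg (γ : ℝ → X d 𝕜) {a b : ℝ} (hab : a ≤ b) : 0 ≤ length γ a b :=
  intervalIntegral.integral_nonneg hab fun _ _ => Real.sqrt_nonneg _

theorem rdist_le {γ : ℝ → X d 𝕜} (h : IsCurve 1 γ) :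
    rdist (γ 0) (γ 1) ≤ ENNReal.ofReal (length γ 0 1) :=
  iInf₂_le γ ⟨h, rfl, rfl⟩

theorem rdist_self (p : X d 𝕜) : rdist p p = 0 := by
  have h : IsCurve 1 (fun _ : ℝ => p) := fun i j => contDiff_const
  refine le_antisymm ((rdist_le h).trans ?_) (zero_le)
  have : ∀ t, velocity (fun _ : ℝ => p) t = 0 := fun t => (HasMDerivAt.const p.1 t).mderiv
  simp [length, this, tnorm, metric]

theorem rdist_comm (p q : X d 𝕜) : rdist p q = rdist q p := by
  have key : ∀ p q : X d 𝕜, rdist p q ≤ rdist q p := fun p q => by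
    refine le_iInf₂ fun γ hγ => ?_
    obtain ⟨h, rfl, rfl⟩ := hγ
    have h' : IsCurve 1 (fun s => γ (1 - s)) := h.comp (contDiff_const.sub contDiff_id)
    simpa [length_reverse h] using rdist_le h'
  exact le_antisymm (key p q) (key q p)

theorem rdist_triangle (p q r : X d 𝕜) : rdist p r ≤ rdist p q + rdist q r := by
  have key : ∀ γ₁ γ₂ : ℝ → X d 𝕜, IsCurve 1 γ₁ → IsCurve 1 γ₂ → γ₁ 1 = γ₂ 0 →
      rdist (γ₁ 0) (γ₂ 1) ≤
        ENNReal.ofReal (length γ₁ 0 1) + ENNReal.ofReal (length γ₂ 0 1) := by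
    intro γ₁ γ₂ h₁ h₂ hm
    -- concatenate after slowing both curves down to rest at their ends
    let σ₁ : ℝ → ℝ := fun t => Real.smoothTransition (2 * t)
    let σ₂ : ℝ → ℝ := fun t => Real.smoothTransition (2 * t - 1)
    have hσ₁ : ContDiff ℝ 1 σ₁ :=
      (Real.smoothTransition.contDiff (n := 1)).comp (contDiff_const.mul contDiff_id)
    have hσ₂ : ContDiff ℝ 1 σ₂ :=
      (Real.smoothTransition.contDiff (n := 1)).comp
        ((contDiff_const.mul contDiff_id).sub contDiff_const)
    have m₁ : Monotone σ₁ := fun a b hab => Real.smoothTransition.monotone (by linarith)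
    have m₂ : Monotone σ₂ := fun a b hab => Real.smoothTransition.monotone (by linarith)
    have e₁ : ∀ t, 1 / 2 ≤ t → σ₁ t = 1 := fun t ht =>
      Real.smoothTransition.one_of_one_le (by linarith)
    have e₂ : ∀ t, t ≤ 1 / 2 → σ₂ t = 0 := fun t ht =>
      Real.smoothTransition.zero_of_nonpos (by linarith)
    have e₁' : σ₁ 0 = 0 := Real.smoothTransition.zero_of_nonpos (by simp)
    have e₂' : σ₂ 1 = 1 := Real.smoothTransition.one_of_one_le (by norm_num)
    let δ : ℝ → X d 𝕜 := fun t => if t ≤ 1 / 2 then γ₁ (σ₁ t) else γ₂ (σ₂ t)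
    have hδ : IsCurve 1 δ := by
      intro i j
      have : (fun t => (δ t).1 i j) =
          fun t => (γ₁ (σ₁ t)).1 i j + (γ₂ (σ₂ t)).1 i j - (γ₂ 0).1 i j := by
        funext t
        by_cases ht : t ≤ 1 / 2
        · simp only [δ, ht, if_true, e₂ t ht]; ring
        · simp only [δ, ht, if_false, e₁ t (le_of_not_ge ht), hm]; ring
      rw [this]
      exact ((h₁.comp hσ₁ i j).add (h₂.comp hσ₂ i j)).sub contDiff_const
    have i1 : length δ 0 (1 / 2) = length γ₁ 0 1 := by
      have := length_comp h₁ hσ₁ m₁ 0 (1 / 2)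
      rw [e₁', e₁ _ le_rfl] at this
      rw [← this]
      refine intervalIntegral.integral_congr_ae ?_
      have hne : ∀ᵐ t : ℝ, t ≠ 1 / 2 := by
        simp [MeasureTheory.ae_iff]
      filter_upwards [hne] with t ht1 ht2
      rw [Set.uIoc_of_le (by norm_num)] at ht2
      have hlt : t < 1 / 2 := lt_of_le_of_ne ht2.2 ht1
      have hev : (δ : ℝ → X d 𝕜) =ᶠ[nhds t] fun s => γ₁ (σ₁ s) := by
        filter_upwards [Iio_mem_nhds hlt] with s hs
        have hs' : s ≤ 1 / 2 := le_of_lt (Set.mem_Iio.1 hs)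
        simp only [δ, hs', if_true]
      have hvel : velocity δ t = velocity (fun s => γ₁ (σ₁ s)) t := by
        ext i j
        exact Filter.EventuallyEq.deriv_eq (hev.fun_comp fun x => x.1 i j)
      rw [hvel, hev.eq_of_nhds]
    have i2 : length δ (1 / 2) 1 = length γ₂ 0 1 := by
      have := length_comp h₂ hσ₂ m₂ (1 / 2) 1
      rw [e₂', e₂ _ le_rfl] at this
      rw [← this]
      refine intervalIntegral.integral_congr_ae ?_
      filter_upwards with t ht2
      rw [Set.uIoc_of_le (by norm_num)] at ht2
      have hlt : 1 / 2 < t := ht2.1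
      have hev : (δ : ℝ → X d 𝕜) =ᶠ[nhds t] fun s => γ₂ (σ₂ s) := by
        filter_upwards [Ioi_mem_nhds hlt] with s hs
        have hs' : ¬ s ≤ 1 / 2 := not_le_of_gt (Set.mem_Ioi.1 hs)
        simp only [δ, hs', if_false]
      have hvel : velocity δ t = velocity (fun s => γ₂ (σ₂ s)) t := by
        ext i j
        exact Filter.EventuallyEq.deriv_eq (hev.fun_comp fun x => x.1 i j)
      rw [hvel, hev.eq_of_nhds]
    have hsum : length δ 0 1 = length γ₁ 0 1 + length γ₂ 0 1 := by
      rw [← i1, ← i2]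
      exact (intervalIntegral.integral_add_adjacent_intervals
        (hδ.continuous_speed.intervalIntegrable _ _)
        (hδ.continuous_speed.intervalIntegrable _ _)).symm
    have hle := rdist_le hδ
    rw [hsum, ENNReal.ofReal_add (length_nonneg _ zero_le_one)
      (length_nonneg _ zero_le_one)] at hle
    have d0 : δ 0 = γ₁ 0 := by simp [δ, e₁']
    have d1 : δ 1 = γ₂ 1 := by
      have : ¬ ((1 : ℝ) ≤ 1 / 2) := by norm_num
      simp only [δ, this, if_false, e₂']
    rwa [d0, d1] at hle
  rw [rdist.eq_def p q, rdist.eq_def q r]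
  refine ENNReal.le_iInf₂_add_iInf₂ fun γ₁ h₁ γ₂ h₂ => ?_
  have := key γ₁ γ₂ h₁.1 h₂.1 (h₁.2.2.trans h₂.2.1.symm)
  rwa [h₁.2.1, h₂.2.2] at this

/-! The action is isometric. -/

theorem smul_val_inv (g : SL d 𝕜) (p : X d 𝕜) :
    (g • p).1⁻¹ = (g.1ᴴ)⁻¹ * p.1⁻¹ * g.1⁻¹ := by
  rw [smul_val, Matrix.mul_inv_rev, Matrix.mul_inv_rev, Matrix.mul_assoc]

theorem SL.isUnit_det (g : SL d 𝕜) : IsUnit g.1.det := by rw [g.2]; exact isUnit_one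

theorem SL.isUnit_det_conjTranspose (g : SL d 𝕜) : IsUnit g.1ᴴ.det := by
  rw [Matrix.det_conjTranspose, g.2]; simp

theorem smul_inv_mul (g : SL d 𝕜) (p : X d 𝕜) (V : Mat d 𝕜) :
    (g • p).1⁻¹ * (g.1 * V * g.1ᴴ) = (g.1ᴴ)⁻¹ * (p.1⁻¹ * V) * g.1ᴴ := by
  rw [smul_val_inv]
  simp only [Matrix.mul_assoc]
  rw [Matrix.nonsing_inv_mul_cancel_left _ _ (SL.isUnit_det g)]

theorem metric_smul (g : SL d 𝕜) (p : X d 𝕜) (V W : Mat d 𝕜) :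
    metric (g • p) (g.1 * V * g.1ᴴ) (g.1 * W * g.1ᴴ) = metric p V W := by
  have : (g • p).1⁻¹ * (g.1 * V * g.1ᴴ) * (g • p).1⁻¹ * (g.1 * W * g.1ᴴ) =
      (g.1ᴴ)⁻¹ * (p.1⁻¹ * V * p.1⁻¹ * W * g.1ᴴ) := by
    rw [Matrix.mul_assoc _ (g • p).1⁻¹, smul_inv_mul, smul_inv_mul]
    simp only [Matrix.mul_assoc]
    rw [Matrix.mul_nonsing_inv_cancel_left _ _ (SL.isUnit_det_conjTranspose g)]
  rw [metric, this, Matrix.trace_mul_comm, Matrix.mul_assoc,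
    Matrix.mul_nonsing_inv _ (SL.isUnit_det_conjTranspose g), mul_one, metric]

theorem IsCurve.smul {n : WithTop ℕ∞} {γ : ℝ → X d 𝕜} (h : IsCurve n γ) (g : SL d 𝕜) :
    IsCurve n (fun t => g • γ t) := by
  intro i j
  simp only [smul_val, Matrix.mul_apply]
  exact ContDiff.sum fun k _ => (ContDiff.sum fun l _ => contDiff_const.mul (h l k)).mul
    contDiff_const

theorem velocity_smul {n : WithTop ℕ∞} (hn : n ≠ 0) {γ : ℝ → X d 𝕜} (h : IsCurve n γ)
    (g : SL d 𝕜) (t : ℝ) :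
    velocity (fun s => g • γ s) t = g.1 * velocity γ t * g.1ᴴ :=
  ((h.hasMDerivAt hn t).const_mul_mul g.1 g.1ᴴ).mderiv

theorem rdist_smul_le (g : SL d 𝕜) (p q : X d 𝕜) : rdist (g • p) (g • q) ≤ rdist p q := by
  refine le_iInf₂ fun γ hγ => ?_
  obtain ⟨h, rfl, rfl⟩ := hγ
  have hl : length (fun s => g • γ s) 0 1 = length γ 0 1 := by
    simp only [length, velocity_smul one_ne_zero h, tnorm, metric_smul]
  simpa [hl] using rdist_le (h.smul g)

/-! ### Geodesics -/

/-- The covariant derivative along the curve `γ` of a vector field `W` along `γ`, for the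
Levi-Civita connection of `metric`. In the linear coordinates given by the matrix entries the
Christoffel symbol of the metric `½ Tr(p⁻¹ V p⁻¹ W)` is
`Γ_p(V, W) = -½ (V p⁻¹ W + W p⁻¹ V)`: it is symmetric (no torsion) and it makes the metric
parallel (`hasDerivAt_metric` below). It preserves tangency to `X`, since
`Tr(p⁻¹ (D_t W)) = (Tr(p⁻¹ W))'`. -/
def covDeriv (γ : ℝ → X d 𝕜) (W : ℝ → Mat d 𝕜) (t : ℝ) : Mat d 𝕜 :=
  mderiv W t - (1 / 2 : 𝕜) •
    (velocity γ t * (γ t).1⁻¹ * W t + W t * (γ t).1⁻¹ * velocity γ t)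

/-- The connection is compatible with the metric. -/
theorem hasDerivAt_metric {γ : ℝ → X d 𝕜} (h : IsCurve 1 γ) {V W : ℝ → Mat d 𝕜} {t : ℝ}
    (hV : ∀ i j, DifferentiableAt ℝ (fun s => V s i j) t)
    (hW : ∀ i j, DifferentiableAt ℝ (fun s => W s i j) t) :
    HasDerivAt (fun s => metric (γ s) (V s) (W s))
      (metric (γ t) (covDeriv γ V t) (W t) + metric (γ t) (V t) (covDeriv γ W t)) t := by
  have dV : HasMDerivAt V (mderiv V t) t := fun i j => (hV i j).hasDerivAt
  have dW : HasMDerivAt W (mderiv W t) t := fun i j => (hW i j).hasDerivAt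
  have di := h.hasMDerivAt_inv one_ne_zero t
  have dall := ((di.mul dV).mul di).mul dW
  have dtr := HasDerivAt.fun_sum fun i (_ : i ∈ Finset.univ) => dall i i
  have dre := (RCLike.reCLM.hasFDerivAt.comp_hasDerivAt t dtr).const_mul (1 / 2 : ℝ)
  refine dre.congr_deriv ?_
  have tr : ∀ A : Mat d 𝕜, ∑ i, A i i = A.trace := fun A => rfl
  simp only [tr, metric, RCLike.reCLM_apply]
  rw [← mul_add, ← map_add]
  congr 2
  set P := (γ t).1⁻¹
  set U := velocity γ t
  have c1 : (P * V t * P * W t * P * U).trace = (P * U * P * V t * P * W t).trace := by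
    rw [show P * V t * P * W t * P * U = (P * V t * P * W t) * (P * U) by noncomm_ring,
      Matrix.trace_mul_comm]
    congr 1; noncomm_ring
  simp only [covDeriv, mul_sub, sub_mul, Matrix.mul_smul, Matrix.smul_mul, mul_add, add_mul,
    Matrix.trace_add, Matrix.trace_sub, Matrix.trace_smul, neg_mul, mul_neg, Matrix.trace_neg,
    smul_eq_mul, ← Matrix.mul_assoc]
  rw [c1]
  ring

/-- A unit-speed geodesic ray. As `X` is geodesically complete, a ray extends
uniquely to a geodesic on `ℝ`, and is stored as this extension; the ray itself is the
restriction to `[0, ∞)`. -/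
@[ext] structure Ray (d : ℕ) (𝕜 : Type*) [RCLike 𝕜] where
  toFun : ℝ → X d 𝕜
  smooth : IsCurve ∞ toFun
  geodesic : ∀ t, covDeriv toFun (velocity toFun) t = 0
  unit_speed : ∀ t, metric (toFun t) (velocity toFun t) (velocity toFun t) = 1

/-- Asymptotic rays: rays staying at bounded distance. -/
def Asymptotic (c c' : Ray d 𝕜) : Prop :=
  ∃ C : ENNReal, C ≠ ⊤ ∧ ∀ t : ℝ, 0 ≤ t → rdist (c.toFun t) (c'.toFun t) ≤ C


/-- Being asymptotic is an equivalence relation on rays. -/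
instance raySetoid (d : ℕ) (𝕜 : Type*) [RCLike 𝕜] : Setoid (Ray d 𝕜) where
  r := Asymptotic
  iseqv :=
    { refl := fun _ => ⟨0, ENNReal.zero_ne_top, fun _ _ => (rdist_self _).le⟩
      symm := fun ⟨C, hC, h⟩ => ⟨C, hC, fun t ht => (rdist_comm _ _).le.trans (h t ht)⟩
      trans := fun ⟨C, hC, h⟩ ⟨C', hC', h'⟩ => ⟨C + C', ENNReal.add_ne_top.2 ⟨hC, hC'⟩,
        fun t ht => (rdist_triangle _ _ _).trans (add_le_add (h t ht) (h' t ht))⟩ }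

/-- The visual boundary of `X`: unit-speed geodesic rays up to asymptotic equivalence. -/
def Boundary (d : ℕ) (𝕜 : Type*) [RCLike 𝕜] : Type _ := Quotient (raySetoid d 𝕜)

/-- The endpoint at infinity of a ray. -/
def Ray.endpoint (c : Ray d 𝕜) : Boundary d 𝕜 := Quotient.mk _ c

/-- `SL(d, 𝕜)` acts on rays. -/
instance : SMul (SL d 𝕜) (Ray d 𝕜) where
  smul g c :=
    { toFun := fun t => g • c.toFun t
      smooth := c.smooth.smul g
      geodesic := by
        intro t
        have hn : ((⊤ : ℕ∞) : WithTop ℕ∞) ≠ 0 := by simp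
        have hv : velocity (fun s => g • c.toFun s) =
            fun s => g.1 * velocity c.toFun s * g.1ᴴ :=
          funext fun s => velocity_smul hn c.smooth g s
        have hvd : HasMDerivAt (velocity c.toFun) (mderiv (velocity c.toFun) t) t := by
          intro i j
          have := (contDiff_infty_iff_deriv.1 (c.smooth i j)).2
          exact (this.differentiable hn t).hasDerivAt
        have h0 := c.geodesic t
        have h1 : covDeriv (fun s => g • c.toFun s) (velocity fun s => g • c.toFun s) t =
            g.1 * covDeriv c.toFun (velocity c.toFun) t * g.1ᴴ := by
          have key : ∀ A B : Mat d 𝕜, (g.1 * A * g.1ᴴ) * (g • c.toFun t).1⁻¹ * (g.1 * B * g.1ᴴ)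
              = g.1 * (A * (c.toFun t).1⁻¹ * B) * g.1ᴴ := by
            intro A B
            rw [Matrix.mul_assoc _ (g • c.toFun t).1⁻¹, smul_inv_mul]
            simp only [Matrix.mul_assoc]
            rw [Matrix.mul_nonsing_inv_cancel_left _ _ (SL.isUnit_det_conjTranspose g)]
          rw [covDeriv, hv, (hvd.const_mul_mul g.1 g.1ᴴ).mderiv]
          simp only [key, covDeriv, mul_sub, sub_mul, mul_add, add_mul, Matrix.mul_smul,
            Matrix.smul_mul]
        rw [h1, h0]; simp
      unit_speed := by
        intro t
        rw [velocity_smul (by simp) c.smooth, metric_smul, c.unit_speed] }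

/-- The action of `SL(d, 𝕜)` on the visual boundary: `g • [c] = [g • c]`. -/
instance : SMul (SL d 𝕜) (Boundary d 𝕜) where
  smul g := Quotient.map (g • ·) fun _ _ ⟨C, hC, h⟩ =>
    ⟨C, hC, fun t ht => (rdist_smul_le g _ _).trans (h t ht)⟩

/-! ### The ideal points of lines and hyperplanes -/

theorem exp_diag (a : Fin d → ℝ) (t : ℝ) :
    NormedSpace.exp (t • Matrix.diagonal fun i => (a i : 𝕜)) =
      Matrix.diagonal fun i => ((Real.exp (t * a i) : ℝ) : 𝕜) := by
  have : (t • Matrix.diagonal fun i => (a i : 𝕜)) =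
      Matrix.diagonal fun i => ((t * a i : ℝ) : 𝕜) := by
    rw [← Matrix.diagonal_smul]
    congr 1; funext i
    simp [RCLike.real_smul_eq_coe_mul]
  rw [this, Matrix.exp_diagonal]
  congr 1; funext i
  rw [Pi.coe_exp, Real.exp_eq_exp_ℝ]
  exact (NormedSpace.map_exp (algebraMap ℝ 𝕜) (RCLike.continuous_ofReal) (t * a i)).symm

/-- `exp(tA) ∈ SL(d, 𝕜)` for a real diagonal matrix `A` of trace zero. -/
def expDiag (𝕜 : Type*) [RCLike 𝕜] (a : Fin d → ℝ) (h0 : ∑ i, a i = 0) (t : ℝ) : SL d 𝕜 :=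
  ⟨NormedSpace.exp (t • Matrix.diagonal fun i => (a i : 𝕜)), by
    rw [exp_diag, Matrix.det_diagonal, ← RCLike.ofReal_prod, ← Real.exp_sum, ← Finset.mul_sum, h0]
    simp⟩

theorem expDiag_smul_basePoint (a : Fin d → ℝ) (h0 : ∑ i, a i = 0) (t : ℝ) :
    (expDiag 𝕜 a h0 t • basePoint d 𝕜).1 =
      Matrix.diagonal fun i => ((Real.exp (2 * a i * t) : ℝ) : 𝕜) := by
  rw [smul_val]
  simp only [expDiag, basePoint, exp_diag, mul_one, Matrix.diagonal_conjTranspose,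
    Matrix.diagonal_mul_diagonal]
  congr 1; funext i
  simp only [Pi.star_apply, RCLike.star_def, RCLike.conj_ofReal]
  rw [← RCLike.ofReal_mul, ← Real.exp_add]
  congr 2; ring

theorem expDiag_smul_basePoint_inv (a : Fin d → ℝ) (h0 : ∑ i, a i = 0) (t : ℝ) :
    (expDiag 𝕜 a h0 t • basePoint d 𝕜).1⁻¹ =
      Matrix.diagonal fun i => ((Real.exp (-(2 * a i * t)) : ℝ) : 𝕜) := by
  refine Matrix.inv_eq_left_inv ?_
  rw [expDiag_smul_basePoint, Matrix.diagonal_mul_diagonal, ← Matrix.diagonal_one]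
  congr 1; funext i
  rw [← RCLike.ofReal_mul, ← Real.exp_add]; simp

theorem hasMDerivAt_diag (a b : Fin d → ℝ) (t : ℝ) :
    HasMDerivAt (fun s => Matrix.diagonal fun i => ((b i * Real.exp (a i * s) : ℝ) : 𝕜))
      (Matrix.diagonal fun i => ((b i * a i * Real.exp (a i * t) : ℝ) : 𝕜)) t := by
  intro i j
  by_cases hij : i = j
  · subst hij
    simp only [Matrix.diagonal_apply_eq]
    have h : HasDerivAt (fun s => b i * Real.exp (a i * s)) (b i * a i * Real.exp (a i * t)) t := by
      have := (((hasDerivAt_id t).const_mul (a i)).exp).const_mul (b i)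
      refine this.congr_deriv ?_
      simp; ring
    exact (RCLike.ofRealCLM (K := 𝕜)).hasFDerivAt.comp_hasDerivAt t h
  · simp only [Matrix.diagonal_apply_ne _ hij]
    exact hasDerivAt_const t 0

/-- For a real diagonal matrix `A` of trace zero with `2 Tr(A²) = 1`, the unit-speed
geodesic `t ↦ exp(tA) • I_d`. -/
def diagRay (𝕜 : Type*) [RCLike 𝕜] (a : Fin d → ℝ) (h0 : ∑ i, a i = 0)
    (h1 : 2 * ∑ i, a i ^ 2 = 1) : Ray d 𝕜 :=
  have hvel : velocity (fun t => expDiag 𝕜 a h0 t • basePoint d 𝕜) =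
      fun t => Matrix.diagonal fun i => ((2 * a i * Real.exp (2 * a i * t) : ℝ) : 𝕜) := by
    funext t
    have := (hasMDerivAt_diag (𝕜 := 𝕜) (fun i => 2 * a i) 1 t).mderiv
    simp only [Pi.one_apply, one_mul] at this
    simpa only [velocity, expDiag_smul_basePoint] using this
  { toFun := fun t => expDiag 𝕜 a h0 t • basePoint d 𝕜
    smooth := by
      intro i j
      simp only [expDiag_smul_basePoint]
      by_cases hij : i = j
      · subst hij
        simp only [Matrix.diagonal_apply_eq]
        exact (RCLike.ofRealCLM (K := 𝕜)).contDiff.comp ((contDiff_const.mul contDiff_id).exp)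
      · simp only [Matrix.diagonal_apply_ne _ hij]
        exact contDiff_const
    geodesic := by
      intro t
      have := (hasMDerivAt_diag (𝕜 := 𝕜) (fun i => 2 * a i) (fun i => 2 * a i) t).mderiv
      rw [covDeriv, hvel, this, expDiag_smul_basePoint_inv]
      simp only [Matrix.diagonal_mul_diagonal]
      rw [Matrix.diagonal_add, ← Matrix.diagonal_smul, sub_eq_zero]
      congr 1; funext i
      have e : Real.exp (-(2 * a i * t)) * Real.exp (2 * a i * t) = 1 := by
        rw [← Real.exp_add]; simp
      have e' : (((Real.exp (-(2 * a i * t)) : ℝ) : 𝕜)) * ((Real.exp (2 * a i * t) : ℝ) : 𝕜) = 1 := by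
        rw [← RCLike.ofReal_mul, e]; simp
      simp only [Pi.smul_apply, smul_eq_mul, RCLike.ofReal_mul, RCLike.ofReal_ofNat]
      linear_combination (-(4 : 𝕜)) * (a i : 𝕜) ^ 2 * ((Real.exp (2 * a i * t) : ℝ) : 𝕜) * e'
    unit_speed := by
      intro t
      rw [hvel, metric, expDiag_smul_basePoint_inv]
      simp only [Matrix.diagonal_mul_diagonal, Matrix.trace_diagonal, ← RCLike.ofReal_mul,
        map_sum, RCLike.ofReal_re]
      refine Eq.trans ?_ h1
      rw [Finset.mul_sum, Finset.mul_sum]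
      refine Finset.sum_congr rfl fun i _ => ?_
      have e : Real.exp (-(2 * a i * t)) * Real.exp (2 * a i * t) = 1 := by
        rw [← Real.exp_add]; simp
      linear_combination (2 * a i ^ 2 * (Real.exp (-(2 * a i * t)) * Real.exp (2 * a i * t) + 1)) * e }

/-- The diagonal of `Z = (2d(d-1))^{-1/2} diag(d-1, -1, …, -1)`. -/
def zDiag (d : ℕ) (i : Fin d) : ℝ :=
  (if i.val = 0 then (d : ℝ) - 1 else -1) / Real.sqrt (2 * d * (d - 1))

theorem sum_first (hd : 2 ≤ d) (x y : ℝ) :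
    ∑ i : Fin d, (if i.val = 0 then x else y) = x + (d - 1) * y := by
  obtain ⟨n, rfl⟩ : ∃ n, d = n + 1 := ⟨d - 1, by omega⟩
  rw [Fin.sum_univ_succ]
  simp

theorem sum_zDiag (hd : 2 ≤ d) : ∑ i, zDiag d i = 0 := by
  simp only [zDiag]
  rw [← Finset.sum_div, sum_first hd]
  simp

theorem sum_zDiag_sq (hd : 2 ≤ d) : 2 * ∑ i, zDiag d i ^ 2 = 1 := by
  have h2 : (2 : ℝ) ≤ d := by exact_mod_cast hd
  have hpos : (0 : ℝ) < 2 * d * (d - 1) := by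
    have : (0 : ℝ) < d - 1 := by linarith
    positivity
  simp only [zDiag, div_pow, Real.sq_sqrt hpos.le, ite_pow]
  rw [← Finset.sum_div, sum_first hd]
  have h3 : (d : ℝ) - 1 ≠ 0 := by linarith
  field_simp
  ring

/-- The ray `c_Z(t) = exp(tZ) • I_d`. -/
def rayZ (𝕜 : Type*) [RCLike 𝕜] (hd : 2 ≤ d) : Ray d 𝕜 :=
  diagRay 𝕜 (zDiag d) (sum_zDiag hd) (sum_zDiag_sq hd)

/-- The ray `c_{-Z}(t) = exp(-tZ) • I_d`. -/
def rayNegZ (𝕜 : Type*) [RCLike 𝕜] (hd : 2 ≤ d) : Ray d 𝕜 :=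
  diagRay 𝕜 (fun i => -zDiag d i) (by simp [sum_zDiag hd]) (by simp [sum_zDiag_sq hd])

/-- The first standard basis vector `e_1`. -/
def e1 (𝕜 : Type*) [RCLike 𝕜] (hd : 2 ≤ d) : Fin d → 𝕜 := Pi.single ⟨0, by omega⟩ 1

theorem e1_ne_zero (𝕜 : Type*) [RCLike 𝕜] (hd : 2 ≤ d) : e1 𝕜 hd ≠ 0 := by
  simp [e1]

/-- The line `[e_1]`, spanned by the `(d-1)`-eigenvector of (the multiple of) `Z`. -/
def line1 (𝕜 : Type*) [RCLike 𝕜] (hd : 2 ≤ d) : ℙ 𝕜 (Fin d → 𝕜) :=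
  Projectivization.mk 𝕜 (e1 𝕜 hd) (e1_ne_zero 𝕜 hd)

/-- The hyperplane of `𝕜^d` given by a point of the dual projective space: the kernel of any
functional representing it. -/
def hyperplane (τ : ℙ 𝕜 (Module.Dual 𝕜 (Fin d → 𝕜))) : Submodule 𝕜 (Fin d → 𝕜) :=
  τ.submodule.dualCoannihilator

/-- The hyperplane spanned by `e_2, …, e_d`, fixed by the stabilizer of the endpoint
of `c_{-Z}`. -/
def hyperplane1 (𝕜 : Type*) [RCLike 𝕜] (hd : 2 ≤ d) : Submodule 𝕜 (Fin d → 𝕜) :=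
  Submodule.span 𝕜 {v | ∃ i : Fin d, i ≠ ⟨0, by omega⟩ ∧ v = Pi.single i 1}

theorem exists_smul_line (hd : 2 ≤ d) (τ : ℙ 𝕜 (Fin d → 𝕜)) :
    ∃ g : SL d 𝕜, g • line1 𝕜 hd = τ :=
  MulAction.exists_smul_eq (SL d 𝕜) _ _

theorem mem_hyperplane1 (hd : 2 ≤ d) (v : Fin d → 𝕜) :
    v ∈ hyperplane1 𝕜 hd ↔ v ⟨0, by omega⟩ = 0 := by
  constructor
  · intro h
    have : hyperplane1 𝕜 hd ≤ LinearMap.ker (LinearMap.proj (R := 𝕜) (φ := fun _ : Fin d => 𝕜) ⟨0, by omega⟩) := by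
      refine Submodule.span_le.2 ?_
      rintro _ ⟨i, hi, rfl⟩
      simp [hi.symm]
    simpa using this h
  · intro h
    have hv : v = ∑ i, v i • (Pi.single i 1 : Fin d → 𝕜) := by
      funext j; simp [Finset.sum_apply, Pi.single_apply]
    rw [hv]
    refine Submodule.sum_mem _ fun i _ => ?_
    by_cases hi : i = ⟨0, by omega⟩
    · subst hi; simp [h]
    · exact Submodule.smul_mem _ _ (Submodule.subset_span ⟨i, hi, rfl⟩)

theorem exists_map_hyperplane (hd : 2 ≤ d) (τ : ℙ 𝕜 (Module.Dual 𝕜 (Fin d → 𝕜))) :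
    ∃ g : SL d 𝕜, (hyperplane1 𝕜 hd).map (Matrix.toLin' g.1) = hyperplane τ := by
  induction τ using Projectivization.ind with
  | h f hf =>
    let w : Fin d → 𝕜 := fun i => f (Pi.single i 1)
    have hfw : ∀ x, f x = ∑ i, w i * x i := by
      intro x
      conv_lhs => rw [← Finset.univ_sum_single x]
      rw [map_sum]
      refine Finset.sum_congr rfl fun i _ => ?_
      have : (Pi.single i (x i) : Fin d → 𝕜) = x i • Pi.single i 1 := by
        rw [← Pi.single_smul]; simp
      rw [this, map_smul, smul_eq_mul, mul_comm]
    have hw : w ≠ 0 := by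
      intro h
      exact hf (LinearMap.ext fun x => by simp [hfw, h])
    obtain ⟨h, hh⟩ := exists_smul_line hd (Projectivization.mk 𝕜 w hw)
    rw [line1, Projectivization.smul_mk, Projectivization.mk_eq_mk_iff] at hh
    obtain ⟨a, ha⟩ := hh
    have hcol : ∀ i, h.1 i ⟨0, by omega⟩ = a * w i := by
      intro i
      have := congrFun ha i
      have e : (h • e1 𝕜 hd) i = (h.1 *ᵥ e1 𝕜 hd) i := rfl
      rw [e, e1, Matrix.mulVec_single_one] at this
      exact this.symm
    refine ⟨h.transpose⁻¹, ?_⟩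
    have inv1 : h.transpose.1 * (h.transpose⁻¹).1 = 1 := by
      rw [← Matrix.SpecialLinearGroup.coe_mul]; simp
    have inv2 : (h.transpose⁻¹).1 * h.transpose.1 = 1 := by
      rw [← Matrix.SpecialLinearGroup.coe_mul]; simp
    have hx0 : ∀ x, (h.transpose.1 *ᵥ x) ⟨0, by omega⟩ = a * f x := by
      intro x
      rw [hfw, Finset.mul_sum]
      simp only [Matrix.mulVec, dotProduct]
      refine Finset.sum_congr rfl fun i _ => ?_
      rw [← mul_assoc, ← hcol]; rfl
    have hker : ∀ x, x ∈ hyperplane (Projectivization.mk 𝕜 f hf) ↔ f x = 0 := by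
      intro x
      simp [hyperplane, Submodule.mem_dualCoannihilator, Projectivization.submodule_mk,
        Submodule.mem_span_singleton]
      exact ⟨fun h => (h 1).resolve_left one_ne_zero, fun h _ => Or.inr h⟩
    ext x
    rw [hker, Submodule.mem_map]
    constructor
    · rintro ⟨v, hv, rfl⟩
      rw [mem_hyperplane1] at hv
      have := hx0 ((h.transpose⁻¹).1 *ᵥ v)
      rw [Matrix.mulVec_mulVec, inv1, Matrix.one_mulVec, hv] at this
      simpa using this.symm
    · intro hx
      refine ⟨h.transpose.1 *ᵥ x, ?_, ?_⟩
      · rw [mem_hyperplane1, hx0, hx, mul_zero]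
      · rw [Matrix.toLin'_apply, Matrix.mulVec_mulVec, inv2, Matrix.one_mulVec]

/-- The identification of `𝕜P^{d-1}` with the orbit of the endpoint of `c_Z`: the line
`g • [e_1]` corresponds to the ideal point `g • [c_Z]`, for any `g`. -/
def linePoint (hd : 2 ≤ d) (τ : ℙ 𝕜 (Fin d → 𝕜)) : Boundary d 𝕜 :=
  (exists_smul_line hd τ).choose • (rayZ 𝕜 hd).endpoint

/-- The identification of the dual projective space with the orbit of the endpoint of
`c_{-Z}`: the hyperplane `g ⟨e_2, …, e_d⟩` corresponds to `g • [c_{-Z}]`, for any `g`. -/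
def hyperplanePoint (hd : 2 ≤ d) (τ : ℙ 𝕜 (Module.Dual 𝕜 (Fin d → 𝕜))) : Boundary d 𝕜 :=
  (exists_map_hyperplane hd τ).choose • (rayNegZ 𝕜 hd).endpoint

/-! ### Angles and transversality -/

/-- The initial velocity at `q` of the unit-speed ray from `q` to the ideal point `ξ`. Such a ray
exists and is unique, as `X` is a Hadamard manifold. -/
def direction (q : X d 𝕜) (ξ : Boundary d 𝕜) : Mat d 𝕜 :=
  Classical.epsilon fun v =>
    ∃ c : Ray d 𝕜, c.toFun 0 = q ∧ c.endpoint = ξ ∧ velocity c.toFun 0 = v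

/-- The Riemannian angle at `q` between two ideal points. -/
def angle (q : X d 𝕜) (ξ η : Boundary d 𝕜) : ℝ :=
  Real.arccos (metric q (direction q ξ) (direction q η) /
    (tnorm q (direction q ξ) * tnorm q (direction q η)))

/-- A line and a hyperplane are transverse if they span `𝕜^d`. -/
def Transverse (τ : ℙ 𝕜 (Fin d → 𝕜)) (τ' : ℙ 𝕜 (Module.Dual 𝕜 (Fin d → 𝕜))) : Prop :=
  τ.submodule ⊔ hyperplane τ' = ⊤

end SLSym

end

noncomputable section

namespace SLSym

variable {d : ℕ} {𝕜 : Type*} [RCLike 𝕜]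

/-! ### Spectral form of points -/

/-! Fix `q` and use the Hermitian inner product `q⁻¹` on `𝕜^d`. Let `x` be a unit vector on the line
and `y` a unit normal of the hyperplane. Since `Z` is a multiple of `d e₁e₁† - 1`, the rays from `q`
to the two ideal points have initial velocities `β (d xx† - q)` and `-β (d yy† - q)` with `β =
2/√(2d(d-1))`. Their inner product gives `cos ∠ = (1 - d |⟨y, x⟩|²)/(d - 1)`. This is less than
`1/(d-1)` exactly when `⟨y, x⟩ ≠ 0`, that is, when the line is not contained in the hyperplane
(`exists_cos_angle_eq`, `transverse_mk_iff`).

Two facts justify this computation. First, the ideal points do not depend on the group elements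
chosen: conjugating a suitable block triangular matrix by `exp(tA)` keeps it bounded for `t ≥ 0`, so
it moves the diagonal ray to an asymptotic one (`asymptotic_smul_diagRay`,
`endpoint_smul_diagRay_eq`).

Second, asymptotic rays from one point have the same initial velocity (`Ray.velocity_zero_eq`), so
`direction` is determined by any one ray. At the base point a geodesic is a one-parameter group
(`Ray.apply_add`), and bounded distance gives `c(t) ≤ K c'(t)` as forms with `K` independent of `t`
(`qform_le_of_rdist_le`). As `c(2t) = c(t)²`, monotonicity of the square root improves `K` to `√K`;
iterating, `K` tends to `1`, and by symmetry `c = c'` on `[0, ∞)`. -/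

theorem X.exists_spectral (p : X d 𝕜) : ∃ (U : Mat d 𝕜) (a : Fin d → ℝ), U * Uᴴ = 1 ∧
    p.1 = U * (Matrix.diagonal fun i => ((Real.exp (a i) : ℝ) : 𝕜)) * Uᴴ ∧
    ∑ i, a i = 0 ∧ ∀ i, Real.exp (a i) ≤ RCLike.re p.1.trace := by
  have hH := p.posDef.1
  have hpos := p.posDef.eigenvalues_pos
  refine ⟨hH.eigenvectorUnitary, fun i => Real.log (hH.eigenvalues i),
    Unitary.mul_star_self_of_mem hH.eigenvectorUnitary.2,
    ?_, ?_, ?_⟩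
  · conv_lhs => rw [hH.spectral_theorem]
    rw [Unitary.conjStarAlgAut_apply]
    congr 3
    funext i
    simp [Real.exp_log (hpos i)]
  · rw [← Real.log_prod fun i _ => (hpos i).ne']
    have := hH.det_eq_prod_eigenvalues
    rw [p.det_eq_one, ← RCLike.ofReal_prod] at this
    have h1 : ∏ i, hH.eigenvalues i = 1 := by exact_mod_cast this.symm
    rw [h1, Real.log_one]
  · intro i
    rw [Real.exp_log (hpos i), hH.trace_eq_sum_eigenvalues, ← RCLike.ofReal_sum, RCLike.ofReal_re]
    exact Finset.single_le_sum (f := hH.eigenvalues) (fun j _ => (hpos j).le) (Finset.mem_univ i)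

theorem X.exists_eq_mul_conjTranspose (p : X d 𝕜) : ∃ B : Mat d 𝕜, IsUnit B.det ∧ p.1 = B * Bᴴ := by
  obtain ⟨U, a, -, hp, -, -⟩ := p.exists_spectral
  have h : p.1 = (U * Matrix.diagonal fun i => ((Real.exp (a i / 2) : ℝ) : 𝕜)) *
      (U * Matrix.diagonal fun i => ((Real.exp (a i / 2) : ℝ) : 𝕜))ᴴ := by
    rw [hp, Matrix.conjTranspose_mul, Matrix.diagonal_conjTranspose, Matrix.mul_assoc U,
      Matrix.mul_assoc U, ← Matrix.mul_assoc (Matrix.diagonal _) (Matrix.diagonal _),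
      Matrix.diagonal_mul_diagonal]
    congr 3; funext i
    simp only [Pi.star_apply, RCLike.star_def, RCLike.conj_ofReal]
    rw [← RCLike.ofReal_mul, ← Real.exp_add, add_halves]
  refine ⟨_, ?_, h⟩
  have hd := p.isUnit_det
  rw [h, Matrix.det_mul] at hd
  exact isUnit_of_mul_isUnit_left hd

/-! ### Positivity of the metric -/

theorem metric_comm (p : X d 𝕜) (V W : Mat d 𝕜) : metric p V W = metric p W V := by
  rw [metric, metric, Matrix.mul_assoc, Matrix.trace_mul_comm]
  simp only [Matrix.mul_assoc]

/-- With `p = BB†` and `C = B⁻¹`, the trace is the squared Frobenius norm of `C V C†`. Tangency to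
`X` plays no role, so Cauchy–Schwarz will also apply to rank-one matrices. -/
theorem metric_self_nonneg (p : X d 𝕜) {V : Mat d 𝕜} (hV : V.IsHermitian) : 0 ≤ metric p V V := by
  obtain ⟨B, -, hB⟩ := p.exists_eq_mul_conjTranspose
  have h : p.1⁻¹ = B⁻¹ᴴ * B⁻¹ := by
    rw [hB, Matrix.mul_inv_rev, Matrix.conjTranspose_nonsing_inv]
  set C := B⁻¹
  have h2 : (p.1⁻¹ * V * p.1⁻¹ * V).trace = ((C * V * Cᴴ)ᴴ * (C * V * Cᴴ)).trace := by
    simp only [h, Matrix.conjTranspose_mul, Matrix.conjTranspose_conjTranspose, hV.eq,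
      Matrix.mul_assoc]
    rw [Matrix.trace_mul_comm]
    simp only [Matrix.mul_assoc]
  rw [metric, h2]
  have := (RCLike.nonneg_iff.1 (Matrix.posSemidef_conjTranspose_mul_self (C * V * Cᴴ)).trace_nonneg).1
  positivity

theorem metric_sub_smul (p : X d 𝕜) (V W : Mat d 𝕜) (r : ℝ) :
    metric p (V - r • W) (V - r • W) =
      metric p W W * (r * r) + (-2 * metric p V W) * r + metric p V V := by
  have h := metric_comm p V W
  simp only [metric] at h ⊢
  simp only [mul_sub, sub_mul, Matrix.mul_smul, Matrix.smul_mul, Matrix.trace_sub,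
    Matrix.trace_smul, map_sub, RCLike.smul_re]
  linear_combination r * h

/-- Cauchy–Schwarz, from the discriminant of the nonnegative quadratic `r ↦ ‖V - rW‖²`. -/
theorem metric_sq_le (p : X d 𝕜) {V W : Mat d 𝕜} (hV : V.IsHermitian) (hW : W.IsHermitian) :
    metric p V W ^ 2 ≤ metric p V V * metric p W W := by
  have h : ∀ r : ℝ, 0 ≤ metric p W W * (r * r) + (-2 * metric p V W) * r + metric p V V := by
    intro r
    rw [← metric_sub_smul]
    refine metric_self_nonneg p (hV.sub ?_)
    rw [Matrix.IsHermitian, Matrix.conjTranspose_smul, hW.eq]; simp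
  have := discrim_le_zero h
  rw [discrim] at this
  nlinarith

/-! ### Quadratic forms along curves -/

/-- The quadratic form `w ↦ w† A w` of a Hermitian matrix. -/
def qform (A : Mat d 𝕜) (w : Fin d → 𝕜) : ℝ := RCLike.re (star w ⬝ᵥ A *ᵥ w)

theorem qform_eq_trace (A : Mat d 𝕜) (w : Fin d → 𝕜) :
    (A * Matrix.vecMulVec w (star w)).trace = star w ⬝ᵥ A *ᵥ w := by
  rw [Matrix.mul_vecMulVec, Matrix.trace_vecMulVec, dotProduct_comm]

theorem X.qform_pos (p : X d 𝕜) {w : Fin d → 𝕜} (hw : w ≠ 0) : 0 < qform p.1 w :=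
  p.posDef.re_dotProduct_pos hw

theorem metric_rankOne (p : X d 𝕜) (V : Mat d 𝕜) (w : Fin d → 𝕜) :
    metric p V (p.1 * Matrix.vecMulVec w (star w) * p.1) = 1 / 2 * qform V w := by
  rw [metric, qform, ← qform_eq_trace]
  congr 2
  rw [← Matrix.mul_assoc, ← Matrix.mul_assoc, Matrix.trace_mul_comm]
  simp only [← Matrix.mul_assoc]
  rw [Matrix.mul_nonsing_inv _ p.isUnit_det, one_mul, Matrix.mul_assoc V,
    Matrix.nonsing_inv_mul _ p.isUnit_det, mul_one]

theorem isHermitian_vecMulVec_star (w : Fin d → 𝕜) : (Matrix.vecMulVec w (star w)).IsHermitian := by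
  rw [Matrix.IsHermitian, Matrix.conjTranspose_vecMulVec, star_star]

/-- Cauchy–Schwarz against `p ww† p`: its pairing with `V` is `½ w†Vw` and its squared norm is `½
(w†pw)²`, whence the factor `√2`. -/
theorem abs_qform_le (p : X d 𝕜) {V : Mat d 𝕜} (hV : V.IsHermitian) (w : Fin d → 𝕜) :
    |qform V w| ≤ Real.sqrt 2 * tnorm p V * qform p.1 w := by
  have hq : 0 ≤ qform p.1 w := p.posDef.posSemidef.re_dotProduct_nonneg w
  have hW : (p.1 * Matrix.vecMulVec w (star w) * p.1).IsHermitian := by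
    rw [Matrix.IsHermitian, Matrix.conjTranspose_mul, Matrix.conjTranspose_mul, p.posDef.1.eq,
      (isHermitian_vecMulVec_star w).eq, Matrix.mul_assoc]
  have h := metric_sq_le p hV hW
  have h2 : qform (p.1 * Matrix.vecMulVec w (star w) * p.1) w = qform p.1 w ^ 2 := by
    have him := p.posDef.1.im_star_dotProduct_mulVec_self w
    rw [qform, Matrix.mul_vecMulVec, Matrix.vecMulVec_mul, Matrix.vecMulVec_mulVec,
      ← Matrix.dotProduct_mulVec]
    simp only [op_smul_eq_smul, dotProduct_smul, smul_eq_mul, RCLike.mul_re, him, qform]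
    ring
  rw [metric_rankOne, metric_rankOne, h2] at h
  refine abs_le_of_sq_le_sq ?_ (by unfold tnorm; positivity)
  rw [mul_pow, mul_pow, Real.sq_sqrt zero_le_two, tnorm, Real.sq_sqrt (metric_self_nonneg p hV)]
  nlinarith

theorem velocity_isHermitian {n : WithTop ℕ∞} (hn : n ≠ 0) {γ : ℝ → X d 𝕜} (h : IsCurve n γ)
    (t : ℝ) : (velocity γ t).IsHermitian := by
  ext i j
  have h1 := (h.hasMDerivAt hn t j i).star
  have h2 : (fun s => star ((γ s).1 j i)) = fun s => (γ s).1 i j := by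
    funext s; exact congrFun (congrFun (γ s).posDef.1.eq i) j
  rw [h2] at h1
  exact h1.unique (h.hasMDerivAt hn t i j)

theorem hasDerivAt_qform {W : ℝ → Mat d 𝕜} {W' : Mat d 𝕜} {t : ℝ} (h : HasMDerivAt W W' t)
    (w : Fin d → 𝕜) : HasDerivAt (fun s => qform (W s) w) (qform W' w) t := by
  have h1 : HasDerivAt (fun s => star w ⬝ᵥ W s *ᵥ w) (star w ⬝ᵥ W' *ᵥ w) t := by
    simp only [Matrix.mulVec, dotProduct]
    exact HasDerivAt.fun_sum fun i _ => (HasDerivAt.fun_sum fun j _ =>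
      (h i j).mul_const (w j)).const_mul _
  exact RCLike.reCLM.hasFDerivAt.comp_hasDerivAt t h1

theorem log_qform_sub_le_length {γ : ℝ → X d 𝕜} (h : IsCurve 1 γ) {w : Fin d → 𝕜} (hw : w ≠ 0) :
    Real.log (qform (γ 1).1 w) - Real.log (qform (γ 0).1 w) ≤ Real.sqrt 2 * length γ 0 1 := by
  have hd : ∀ t, HasDerivAt (fun s => Real.log (qform (γ s).1 w))
      (qform (velocity γ t) w / qform (γ t).1 w) t := fun t =>
    (hasDerivAt_qform (h.hasMDerivAt one_ne_zero t) w).log ((γ t).qform_pos hw).ne'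
  rw [length, ← intervalIntegral.integral_const_mul]
  refine intervalIntegral.sub_le_integral_of_hasDeriv_right_of_le zero_le_one
    (fun t _ => (hd t).continuousAt.continuousWithinAt) (fun t _ => (hd t).hasDerivWithinAt)
    ((continuous_const.mul h.continuous_speed).integrableOn_Icc) fun t _ => ?_
  rw [div_le_iff₀ ((γ t).qform_pos hw)]
  exact (le_abs_self _).trans (abs_qform_le _ (velocity_isHermitian one_ne_zero h t) w)

/-- Along any curve `log (w†γw)` changes at rate at most `√2` times the speed; the infimum over
curves turns this into a bound by the distance. It is the only lower bound on `rdist` that the proof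
needs. -/
theorem qform_le_of_rdist_le {p q : X d 𝕜} {C : ENNReal} (hC : C ≠ ⊤) (h : rdist p q ≤ C)
    (w : Fin d → 𝕜) : qform q.1 w ≤ Real.exp (Real.sqrt 2 * C.toReal) * qform p.1 w := by
  by_cases hw : w = 0
  · simp [hw, qform]
  have h1 : ENNReal.ofReal ((Real.log (qform q.1 w) - Real.log (qform p.1 w)) / Real.sqrt 2) ≤
      rdist p q := by
    refine le_iInf₂ fun γ hγ => ?_
    obtain ⟨hc, rfl, rfl⟩ := hγ
    refine ENNReal.ofReal_le_ofReal ?_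
    rw [div_le_iff₀' (by positivity)]
    exact log_qform_sub_le_length hc hw
  have h2 := (ENNReal.ofReal_le_iff_le_toReal hC).1 (h1.trans h)
  rw [div_le_iff₀ (by positivity)] at h2
  rw [← Real.exp_log (q.qform_pos hw), ← Real.exp_log (p.qform_pos hw), ← Real.exp_add]
  exact Real.exp_le_exp.2 (by linarith)

/-! ### Monotonicity of the square root -/

theorem qform_sub (A B : Mat d 𝕜) (w : Fin d → 𝕜) : qform (A - B) w = qform A w - qform B w := by
  simp [qform, Matrix.sub_mulVec, dotProduct_sub]

/-- If `Y - X` had an eigenvector `v` with eigenvalue `r < 0`, then `Xv = Yv - rv` would give `‖Xv‖²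
= ‖Yv‖² - 2r v†Yv + r²‖v‖² > ‖Yv‖²`, against the hypothesis. -/
theorem qform_le_of_qform_sq_le {X Y : Mat d 𝕜} (hX : X.IsHermitian) (hY : Y.PosDef)
    (h : ∀ w, qform (X * X) w ≤ qform (Y * Y) w) (w : Fin d → 𝕜) : qform X w ≤ qform Y w := by
  have hD : (Y - X).IsHermitian := hY.1.sub hX
  suffices hP : (Y - X).PosSemidef by
    have := hP.re_dotProduct_nonneg w
    have h2 := qform_sub Y X w
    rw [qform] at h2
    linarith
  rw [hD.posSemidef_iff_eigenvalues_nonneg]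
  intro i
  by_contra hneg
  rw [Pi.zero_apply, not_le] at hneg
  set r := hD.eigenvalues i
  set v : Fin d → 𝕜 := (hD.eigenvectorBasis i).ofLp
  have hv : v ≠ 0 := by
    intro h0
    have := hD.eigenvectorBasis.orthonormal.ne_zero i
    exact this (by ext j; exact congrFun h0 j)
  have hv1 : (Y - X) *ᵥ v = (r : 𝕜) • v := by
    rw [hD.mulVec_eigenvectorBasis i, RCLike.real_smul_eq_coe_smul (K := 𝕜)]
  have hX1 : X *ᵥ v = Y *ᵥ v - (r : 𝕜) • v := by
    rw [← hv1, Matrix.sub_mulVec, sub_sub_cancel]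
  have sq : ∀ A : Mat d 𝕜, A.IsHermitian → qform (A * A) v =
      RCLike.re (star (A *ᵥ v) ⬝ᵥ (A *ᵥ v)) := by
    intro A hA
    rw [qform, ← Matrix.mulVec_mulVec, Matrix.dotProduct_mulVec, Matrix.star_mulVec, hA.eq]
  have hY2 : star (Y *ᵥ v) ⬝ᵥ v = star v ⬝ᵥ Y *ᵥ v := by
    rw [Matrix.star_mulVec, hY.1.eq, Matrix.dotProduct_mulVec]
  have hvv : 0 < RCLike.re (star v ⬝ᵥ v) := by
    simpa using (Matrix.PosDef.one (n := Fin d) (R := 𝕜)).re_dotProduct_pos hv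
  have hYv := hY.re_dotProduct_pos hv
  have hh := h v
  rw [sq X hX, sq Y hY.1, hX1] at hh
  simp only [star_sub, star_smul, sub_dotProduct, dotProduct_sub, smul_dotProduct, dotProduct_smul,
    hY2, RCLike.star_def, RCLike.conj_ofReal, smul_eq_mul, map_sub, RCLike.re_ofReal_mul] at hh
  nlinarith [mul_pos_of_neg_of_neg hneg hneg]

theorem eq_of_qform_eq {A B : Mat d 𝕜} (hA : A.IsHermitian) (hB : B.IsHermitian)
    (h : ∀ w, qform A w = qform B w) : A = B := by
  have hD := hA.sub hB
  have h0 : (fun i => hD.eigenvalues i) = fun _ => 0 := by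
    funext i
    rw [hD.eigenvalues_eq]
    have := qform_sub A B (hD.eigenvectorBasis i).ofLp
    rw [h, sub_self] at this
    exact this
  exact sub_eq_zero.1 (hD.eigenvalues_eq_zero_iff.1 h0)

/-! ### Transitivity -/

theorem diagonal_mul_diagonal_mul_conjTranspose {δ : Fin d → 𝕜} (hδ : ∀ i, δ i * star (δ i) = 1)
    (a : Fin d → 𝕜) :
    Matrix.diagonal δ * Matrix.diagonal a * (Matrix.diagonal δ)ᴴ = Matrix.diagonal a := by
  rw [Matrix.diagonal_conjTranspose, Matrix.diagonal_mul_diagonal, Matrix.diagonal_mul_diagonal]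
  congr 1; funext i
  rw [Pi.star_apply, mul_right_comm, hδ, one_mul]

theorem exists_specialLinear_eq_mul_diagonal (hd : 0 < d) {M : Mat d 𝕜}
    (hM : (M * Mᴴ).det = 1) : ∃ (h : SL d 𝕜) (δ : Fin d → 𝕜),
      h.1 = M * Matrix.diagonal δ ∧ ∀ i, δ i * star (δ i) = 1 := by
  rw [Matrix.det_mul, Matrix.det_conjTranspose] at hM
  have hδ : ∀ i : Fin d, (if i = ⟨0, hd⟩ then star M.det else 1) *
      star (if i = ⟨0, hd⟩ then star M.det else 1) = 1 := by
    intro i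
    split_ifs
    · rw [star_star, mul_comm, hM]
    · simp
  -- `det M` has modulus one, so multiplying the first column by its conjugate makes the determinant
  -- `1` and leaves `MM†` unchanged.
  refine ⟨⟨M * Matrix.diagonal fun i => if i = ⟨0, hd⟩ then star M.det else 1, ?_⟩, _, rfl, hδ⟩
  rw [Matrix.det_mul, Matrix.det_diagonal, Finset.prod_ite_eq' Finset.univ, if_pos (Finset.mem_univ _),
    hM]

theorem exists_unitary_mulVec_single (i₀ : Fin d) {w : Fin d → 𝕜} (hw : w ≠ 0) :
    ∃ k : Mat d 𝕜, k * kᴴ = 1 ∧ ∃ c : 𝕜, k *ᵥ Pi.single i₀ 1 = c • w := by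
  have hw' : (WithLp.toLp 2 w : EuclideanSpace 𝕜 (Fin d)) ≠ 0 := fun h =>
    hw (congrArg WithLp.ofLp h)
  obtain ⟨r, hr⟩ : ∃ r : 𝕜, ‖r • (WithLp.toLp 2 w : EuclideanSpace 𝕜 (Fin d))‖ = 1 :=
    ⟨_, norm_smul_inv_norm hw'⟩
  obtain ⟨b, hb⟩ := Orthonormal.exists_orthonormalBasis_extension_of_card_eq (𝕜 := 𝕜)
    (E := EuclideanSpace 𝕜 (Fin d)) (ι := Fin d) (by simp)
    (v := fun _ => r • (WithLp.toLp 2 w : EuclideanSpace 𝕜 (Fin d))) (s := {i₀})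
    ⟨fun _ => hr, fun i j hij => absurd (Subsingleton.elim i j) hij⟩
  refine ⟨(EuclideanSpace.basisFun (Fin d) 𝕜).toBasis.toMatrix b, Unitary.mul_star_self_of_mem
    (OrthonormalBasis.toMatrix_orthonormalBasis_mem_unitary _ b), r, ?_⟩
  rw [Matrix.mulVec_single_one]
  funext i
  rw [Matrix.col_apply, Module.Basis.toMatrix_apply, hb i₀ rfl]
  simp

theorem smul_basePoint_eq_of_eq_mul_diagonal {q : X d 𝕜} {h : SL d 𝕜} {M : Mat d 𝕜} {δ : Fin d → 𝕜}
    (hM : M * Mᴴ = q.1) (hh : h.1 = M * Matrix.diagonal δ) (hδ : ∀ i, δ i * star (δ i) = 1) :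
    h • basePoint d 𝕜 = q := by
  refine X.ext ?_
  have h1 := diagonal_mul_diagonal_mul_conjTranspose hδ 1
  have h2 : Matrix.diagonal (1 : Fin d → 𝕜) = 1 := Matrix.diagonal_one
  rw [h2, mul_one] at h1
  rw [smul_val, hh, Matrix.conjTranspose_mul, basePoint, mul_one, Matrix.mul_assoc,
    ← Matrix.mul_assoc (Matrix.diagonal δ), h1, one_mul, hM]

/-- Writing `q = BB†`, every `Bk` with `k` unitary also carries `I` to `q`; take `k` sending `e₁` to
the line of `B⁻¹v`, then correct the phase. The freedom in the line is what lets the rays start at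
`q` and still end at prescribed ideal points. -/
theorem exists_smul_basePoint_eq (hd : 2 ≤ d) (q : X d 𝕜) {v : Fin d → 𝕜} (hv : v ≠ 0) :
    ∃ h : SL d 𝕜, h • basePoint d 𝕜 = q ∧ ∃ c : 𝕜, h.1 *ᵥ e1 𝕜 hd = c • v := by
  obtain ⟨B, hB, hq⟩ := q.exists_eq_mul_conjTranspose
  have hBv : B *ᵥ (B⁻¹ *ᵥ v) = v := by
    rw [Matrix.mulVec_mulVec, Matrix.mul_nonsing_inv _ hB, Matrix.one_mulVec]
  have hw : B⁻¹ *ᵥ v ≠ 0 := by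
    intro h
    rw [h, Matrix.mulVec_zero] at hBv
    exact hv hBv.symm
  obtain ⟨k, hk, c, hkc⟩ := exists_unitary_mulVec_single ⟨0, by omega⟩ hw
  have hM : B * k * (B * k)ᴴ = q.1 := by
    rw [Matrix.conjTranspose_mul, Matrix.mul_assoc B, ← Matrix.mul_assoc k, hk, one_mul, hq]
  obtain ⟨h, δ, hh, hδ⟩ := exists_specialLinear_eq_mul_diagonal (M := B * k) (by omega)
    (by rw [hM, q.det_eq_one])
  refine ⟨h, smul_basePoint_eq_of_eq_mul_diagonal hM hh hδ, δ ⟨0, by omega⟩ * c, ?_⟩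
  have h3 : Matrix.diagonal δ *ᵥ e1 𝕜 hd = δ ⟨0, by omega⟩ • e1 𝕜 hd := by
    rw [e1, Matrix.diagonal_mulVec_single, ← Pi.single_smul, smul_eq_mul]
  rw [hh, ← Matrix.mulVec_mulVec, h3, Matrix.mulVec_smul, ← Matrix.mulVec_mulVec, e1, hkc,
    Matrix.mulVec_smul, hBv, smul_smul]

/-! ### Upper bounds for the distance -/

theorem rdist_expDiag_le (a : Fin d → ℝ) (h0 : ∑ i, a i = 0) :
    rdist (basePoint d 𝕜) (expDiag 𝕜 a h0 1 • basePoint d 𝕜) ≤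
      ENNReal.ofReal (Real.sqrt (2 * ∑ i, a i ^ 2)) := by
  set γ : ℝ → X d 𝕜 := fun t => expDiag 𝕜 a h0 t • basePoint d 𝕜
  have hγ : ∀ t, HasMDerivAt (fun t => (γ t).1)
      (Matrix.diagonal fun i => ((2 * a i * Real.exp (2 * a i * t) : ℝ) : 𝕜)) t := fun t => by
    have := hasMDerivAt_diag (𝕜 := 𝕜) (fun i => 2 * a i) 1 t
    simpa only [Pi.one_apply, one_mul, γ, expDiag_smul_basePoint] using this
  have hc : IsCurve 1 γ := by
    intro i j
    simp only [γ, expDiag_smul_basePoint]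
    by_cases hij : i = j
    · subst hij
      simp only [Matrix.diagonal_apply_eq]
      exact (RCLike.ofRealCLM (K := 𝕜)).contDiff.comp ((contDiff_const.mul contDiff_id).exp)
    · simp only [Matrix.diagonal_apply_ne _ hij]
      exact contDiff_const
  have hv : ∀ t, tnorm (γ t) (velocity γ t) = Real.sqrt (2 * ∑ i, a i ^ 2) := by
    intro t
    rw [velocity, (hγ t).mderiv, tnorm, metric, expDiag_smul_basePoint_inv]
    simp only [Matrix.diagonal_mul_diagonal, Matrix.trace_diagonal, ← RCLike.ofReal_mul,
      map_sum, RCLike.ofReal_re]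
    rw [Finset.mul_sum, Finset.mul_sum]
    congr 1
    refine Finset.sum_congr rfl fun i _ => ?_
    have e : Real.exp (-(2 * a i * t)) * Real.exp (2 * a i * t) = 1 := by
      rw [← Real.exp_add]; simp
    linear_combination (2 * a i ^ 2 * (Real.exp (-(2 * a i * t)) * Real.exp (2 * a i * t) + 1)) * e
  have h := rdist_le hc
  have e0 : γ 0 = basePoint d 𝕜 := by
    refine X.ext ((expDiag_smul_basePoint a h0 0).trans ?_)
    simp [basePoint]
  rw [e0, length] at h
  simpa [hv] using h

/-- A trace bound controls the logarithms of the eigenvalues from above by `log T`; as they sum to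
zero, it controls them from below too. A unitary of determinant one then reduces to the diagonal
case. -/
theorem rdist_basePoint_le (hd : 0 < d) (T : ℝ) : ∃ C : ENNReal, C ≠ ⊤ ∧ ∀ p : X d 𝕜,
    RCLike.re p.1.trace ≤ T → rdist (basePoint d 𝕜) p ≤ C := by
  refine ⟨ENNReal.ofReal (Real.sqrt (2 * ∑ _i : Fin d, (d * Real.log T) ^ 2)),
    ENNReal.ofReal_ne_top, fun p hp => ?_⟩
  obtain ⟨U, a, hU, hpU, ha0, haT⟩ := p.exists_spectral
  have hT : 0 < T := (Real.exp_pos _).trans_le ((haT ⟨0, hd⟩).trans hp)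
  have hle : ∀ i, a i ≤ Real.log T := fun i => by
    rw [Real.le_log_iff_exp_le hT]; exact (haT i).trans hp
  have hbd : ∀ i, |a i| ≤ d * Real.log T := by
    have hl : 0 ≤ Real.log T := by
      have := Finset.sum_le_sum fun i (_ : i ∈ Finset.univ) => hle i
      rw [ha0] at this
      simp only [Finset.sum_const, Finset.card_univ, Fintype.card_fin, nsmul_eq_mul] at this
      exact nonneg_of_mul_nonneg_right this (by exact_mod_cast hd)
    have hd1 : (1 : ℝ) ≤ d := by exact_mod_cast hd
    intro i
    have h1 : ∑ j, (Real.log T - a j) = d * Real.log T := by simp [ha0]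
    have h2 := Finset.single_le_sum (f := fun j => Real.log T - a j)
      (fun j _ => sub_nonneg.2 (hle j)) (Finset.mem_univ i)
    rw [h1] at h2
    rw [abs_le]
    constructor
    · linarith
    · nlinarith [hle i]
  obtain ⟨h, δ, hh, hδ⟩ := exists_specialLinear_eq_mul_diagonal hd (M := U) (by rw [hU]; simp)
  have hs : ∑ i, a i / 2 = 0 := by rw [← Finset.sum_div, ha0, zero_div]
  have key : ∀ b : Fin d → 𝕜, h.1 * Matrix.diagonal b * h.1ᴴ = U * Matrix.diagonal b * Uᴴ := by
    intro b
    rw [hh, Matrix.conjTranspose_mul]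
    conv_rhs => rw [← diagonal_mul_diagonal_mul_conjTranspose hδ b]
    simp only [Matrix.mul_assoc]
  have e0 : h • basePoint d 𝕜 = basePoint d 𝕜 :=
    smul_basePoint_eq_of_eq_mul_diagonal hU hh hδ
  -- The exponents are halved because `exp(A) • I = exp(2A)`.
  have e1 : h • expDiag 𝕜 (fun i => a i / 2) hs 1 • basePoint d 𝕜 = p := by
    refine X.ext ?_
    rw [smul_val, expDiag_smul_basePoint, key, hpU]
    congr 4; funext i
    congr 2; ring
  have := (rdist_smul_le h _ _).trans (rdist_expDiag_le (𝕜 := 𝕜) (fun i => a i / 2) hs)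
  rw [e0, e1] at this
  refine this.trans (ENNReal.ofReal_le_ofReal (Real.sqrt_le_sqrt ?_))
  refine mul_le_mul_of_nonneg_left (Finset.sum_le_sum fun i _ => ?_) zero_le_two
  have := hbd i
  rw [sq_le_sq, abs_div, abs_two]
  have h3 := abs_nonneg (a i)
  rw [abs_of_nonneg (h3.trans this)]
  linarith

/-! ### Rays asymptotic to diagonal rays -/

theorem diagRay_toFun (a : Fin d → ℝ) (h0 : ∑ i, a i = 0) (h1 : 2 * ∑ i, a i ^ 2 = 1) (t : ℝ) :
    (diagRay 𝕜 a h0 h1).toFun t = expDiag 𝕜 a h0 t • basePoint d 𝕜 := rfl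

theorem re_trace_mul_conjTranspose (N : Mat d 𝕜) :
    RCLike.re (N * Nᴴ).trace = ∑ i, ∑ j, ‖N i j‖ ^ 2 := by
  simp only [Matrix.trace, Matrix.diag_apply, Matrix.mul_apply, Matrix.conjTranspose_apply, map_sum,
    RCLike.star_def, RCLike.mul_conj]
  norm_cast

/-- The stabilizer of the endpoint of a diagonal ray contains the corresponding block triangular
matrices. -/
theorem asymptotic_smul_diagRay (hd : 0 < d) (a : Fin d → ℝ) (h0 : ∑ i, a i = 0)
    (h1 : 2 * ∑ i, a i ^ 2 = 1) (p : SL d 𝕜) (hp : ∀ i j, p.1 i j ≠ 0 → a j ≤ a i) :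
    Asymptotic (diagRay 𝕜 a h0 h1) (p • diagRay 𝕜 a h0 h1) := by
  obtain ⟨C, hC, hb⟩ := rdist_basePoint_le (𝕜 := 𝕜) hd (∑ i, ∑ j, ‖p.1 i j‖ ^ 2)
  refine ⟨C, hC, fun t ht => ?_⟩
  change rdist (expDiag 𝕜 a h0 t • basePoint d 𝕜) (p • expDiag 𝕜 a h0 t • basePoint d 𝕜) ≤ C
  set g := expDiag 𝕜 a h0 t
  -- By invariance it suffices to bound the distance from `I` to `(g⁻¹pg) • I`. The entries of
  -- `g⁻¹pg` are `exp(t(a j - a i)) p i j`, hence no larger in norm than those of `p`, so the trace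
  -- is bounded uniformly in `t ≥ 0`.
  have h := rdist_smul_le g (basePoint d 𝕜) ((g⁻¹ * p * g) • basePoint d 𝕜)
  rw [smul_smul, mul_assoc g⁻¹, mul_inv_cancel_left, mul_smul, ← mul_assoc g⁻¹] at h
  refine h.trans (hb _ ?_)
  have hg : ∀ s, (expDiag 𝕜 a h0 s).1 = Matrix.diagonal fun i => ((Real.exp (s * a i) : ℝ) : 𝕜) :=
    fun s => exp_diag a s
  have hginv : g⁻¹ = expDiag 𝕜 a h0 (-t) := by
    refine inv_eq_of_mul_eq_one_right (Subtype.ext ?_)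
    rw [Matrix.SpecialLinearGroup.coe_mul, hg, hg, Matrix.diagonal_mul_diagonal,
      Matrix.SpecialLinearGroup.coe_one, ← Matrix.diagonal_one]
    congr 1; funext i
    rw [← RCLike.ofReal_mul, ← Real.exp_add]; simp
  have hn : ∀ i j, (g⁻¹ * p * g).1 i j =
      ((Real.exp (-t * a i) : ℝ) : 𝕜) * p.1 i j * ((Real.exp (t * a j) : ℝ) : 𝕜) := by
    intro i j
    rw [hginv, Matrix.SpecialLinearGroup.coe_mul, Matrix.SpecialLinearGroup.coe_mul, hg, hg,
      Matrix.mul_diagonal, Matrix.diagonal_mul]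
  rw [smul_val, basePoint, mul_one, re_trace_mul_conjTranspose]
  refine Finset.sum_le_sum fun i _ => Finset.sum_le_sum fun j _ => ?_
  rw [hn]
  gcongr
  by_cases hij : p.1 i j = 0
  · simp [hij]
  · rw [norm_mul, norm_mul, RCLike.norm_ofReal, RCLike.norm_ofReal, abs_of_pos (Real.exp_pos _),
      abs_of_pos (Real.exp_pos _), mul_right_comm, ← Real.exp_add]
    refine mul_le_of_le_one_left (norm_nonneg _) (Real.exp_le_one_iff.2 ?_)
    nlinarith [hp i j hij]

/-! ### Geodesics through the base point -/

theorem HasMDerivAt.eq_of_zero {W : ℝ → Mat d 𝕜} (h : ∀ t, HasMDerivAt W 0 t) (s t : ℝ) :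
    W s = W t := by
  ext i j
  exact is_const_of_deriv_eq_zero (fun t => (h t i j).differentiableAt)
    (fun t => (h t i j).deriv) s t

theorem infty_ne_zero : ((⊤ : ℕ∞) : WithTop ℕ∞) ≠ 0 := by simp

theorem Ray.hasMDerivAt_velocity (c : Ray d 𝕜) (t : ℝ) : HasMDerivAt (velocity c.toFun)
    (velocity c.toFun t * (c.toFun t).1⁻¹ * velocity c.toFun t) t := by
  have h : HasMDerivAt (velocity c.toFun) (mderiv (velocity c.toFun) t) t := fun i j =>
    ((contDiff_infty_iff_deriv.1 (c.smooth i j)).2.differentiable infty_ne_zero t).hasDerivAt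
  have h0 := c.geodesic t
  rw [covDeriv, ← two_smul 𝕜, smul_smul, sub_eq_zero] at h0
  norm_num at h0
  rwa [h0] at h

/-- The geodesic equation reads `c'' = c' c⁻¹ c'`, which says precisely that `c⁻¹c'` has derivative
zero. -/
theorem Ray.inv_mul_velocity (c : Ray d 𝕜) (s t : ℝ) :
    (c.toFun s).1⁻¹ * velocity c.toFun s = (c.toFun t).1⁻¹ * velocity c.toFun t := by
  refine HasMDerivAt.eq_of_zero (W := fun t => (c.toFun t).1⁻¹ * velocity c.toFun t) (fun t => ?_) s t
  have := (c.smooth.hasMDerivAt_inv infty_ne_zero t).mul (c.hasMDerivAt_velocity t)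
  simpa only [Matrix.mul_assoc, neg_mul, neg_add_cancel] using this

theorem Ray.velocity_eq_mul {c : Ray d 𝕜} (h0 : c.toFun 0 = basePoint d 𝕜) (t : ℝ) :
    velocity c.toFun t = (c.toFun t).1 * velocity c.toFun 0 := by
  have h := c.inv_mul_velocity t 0
  rw [h0] at h
  simp only [basePoint, inv_one, one_mul] at h
  rw [← h, Matrix.mul_nonsing_inv_cancel_left _ _ (c.toFun t).isUnit_det]

theorem Ray.velocity_eq_mul' {c : Ray d 𝕜} (h0 : c.toFun 0 = basePoint d 𝕜) (t : ℝ) :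
    velocity c.toFun t = velocity c.toFun 0 * (c.toFun t).1 := by
  have h := congrArg Matrix.conjTranspose (Ray.velocity_eq_mul h0 t)
  rwa [Matrix.conjTranspose_mul, (velocity_isHermitian infty_ne_zero c.smooth t).eq,
    (velocity_isHermitian infty_ne_zero c.smooth 0).eq, (c.toFun t).posDef.1.eq] at h

/-- From `c' = c c'(0) = c'(0) c`, the product `c(t)⁻¹ c(t + s)` is constant in `t`. Only the
resulting identity `c(2t) = c(t)²` is used later. -/
theorem Ray.apply_add {c : Ray d 𝕜} (h0 : c.toFun 0 = basePoint d 𝕜) (t s : ℝ) :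
    (c.toFun (t + s)).1 = (c.toFun t).1 * (c.toFun s).1 := by
  have h : (c.toFun t).1⁻¹ * (c.toFun (t + s)).1 = (c.toFun 0).1⁻¹ * (c.toFun (0 + s)).1 := by
    refine HasMDerivAt.eq_of_zero
      (W := fun t => (c.toFun t).1⁻¹ * (c.toFun (t + s)).1) (fun t => ?_) t 0
    have h1 : HasMDerivAt (fun t => (c.toFun (t + s)).1) (velocity c.toFun (t + s)) t := fun i j =>
      (c.smooth.hasMDerivAt infty_ne_zero (t + s) i j).comp_add_const t s
    have := (c.smooth.hasMDerivAt_inv infty_ne_zero t).mul h1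
    have e : -((c.toFun t).1⁻¹ * velocity c.toFun t * (c.toFun t).1⁻¹) * (c.toFun (t + s)).1 +
        (c.toFun t).1⁻¹ * velocity c.toFun (t + s) = 0 := by
      rw [Ray.velocity_eq_mul' h0 (t + s), Ray.velocity_eq_mul h0 t,
        Matrix.nonsing_inv_mul_cancel_left _ _ (c.toFun t).isUnit_det]
      have h2 := Ray.velocity_eq_mul h0 t
      rw [Ray.velocity_eq_mul' h0 t] at h2
      have h3 : velocity c.toFun 0 * (c.toFun t).1⁻¹ = (c.toFun t).1⁻¹ * velocity c.toFun 0 := by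
        have h4 := congrArg (fun A => (c.toFun t).1⁻¹ * A * (c.toFun t).1⁻¹) h2
        simp only [← Matrix.mul_assoc, Matrix.nonsing_inv_mul _ (c.toFun t).isUnit_det, one_mul]
          at h4
        rw [Matrix.mul_assoc _ (c.toFun t).1, Matrix.mul_nonsing_inv _ (c.toFun t).isUnit_det,
          mul_one] at h4
        exact h4.symm
      rw [h3, neg_mul, Matrix.mul_assoc, neg_add_cancel]
    rwa [e] at this
  rw [h0, zero_add] at h
  simp only [basePoint, inv_one, one_mul] at h
  rw [← h, Matrix.mul_nonsing_inv_cancel_left _ _ (c.toFun t).isUnit_det]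

/-! ### Asymptotic rays from the same point -/

theorem qform_smul (r : ℝ) (A : Mat d 𝕜) (w : Fin d → 𝕜) : qform (r • A) w = r * qform A w := by
  simp [qform, Matrix.smul_mulVec, dotProduct_smul, RCLike.smul_re]

theorem Ray.qform_le_pow {c c' : Ray d 𝕜} (h0 : c.toFun 0 = basePoint d 𝕜)
    (h0' : c'.toFun 0 = basePoint d 𝕜) {K : ℝ} (hK : 0 < K)
    (h : ∀ t, 0 ≤ t → ∀ w, qform (c.toFun t).1 w ≤ K * qform (c'.toFun t).1 w) (n : ℕ) :
    ∀ t, 0 ≤ t → ∀ w, qform (c.toFun t).1 w ≤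
      K ^ ((1 / 2 : ℝ) ^ n) * qform (c'.toFun t).1 w := by
  induction n with
  | zero => simpa using h
  | succ n ih =>
    intro t ht w
    have hr : 0 < K ^ ((1 / 2 : ℝ) ^ (n + 1)) := Real.rpow_pos_of_pos hK _
    have hr2 : K ^ ((1 / 2 : ℝ) ^ (n + 1)) * K ^ ((1 / 2 : ℝ) ^ (n + 1)) =
        K ^ ((1 / 2 : ℝ) ^ n) := by
      rw [← Real.rpow_add hK]; congr 1; ring
    rw [← qform_smul]
    -- The induction hypothesis at time `2t` compares the squares `c(t)²` and `c'(t)²`; the new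
    -- constant is the square root of the old one.
    refine qform_le_of_qform_sq_le (c.toFun t).posDef.1 ((c'.toFun t).posDef.smul hr) (fun v => ?_) w
    rw [Matrix.smul_mul, Matrix.mul_smul, smul_smul, hr2, qform_smul, ← Ray.apply_add h0,
      ← Ray.apply_add h0']
    exact ih (t + t) (by linarith) v

theorem Ray.qform_le {c c' : Ray d 𝕜} (h0 : c.toFun 0 = basePoint d 𝕜)
    (h0' : c'.toFun 0 = basePoint d 𝕜) (h : Asymptotic c c') {t : ℝ} (ht : 0 ≤ t)
    (w : Fin d → 𝕜) : qform (c.toFun t).1 w ≤ qform (c'.toFun t).1 w := by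
  obtain ⟨C, hC, hb⟩ := h
  set K := Real.exp (Real.sqrt 2 * C.toReal)
  have hK : 0 < K := Real.exp_pos _
  have hle := Ray.qform_le_pow h0 h0' hK fun t ht w =>
    qform_le_of_rdist_le hC ((rdist_comm _ _).le.trans (hb t ht)) w
  have hlim : Filter.Tendsto (fun n : ℕ => K ^ ((1 / 2 : ℝ) ^ n) * qform (c'.toFun t).1 w)
      Filter.atTop (nhds (K ^ (0 : ℝ) * qform (c'.toFun t).1 w)) := by
    refine Filter.Tendsto.mul_const _ ?_
    refine (Real.continuousAt_const_rpow hK.ne').tendsto.comp ?_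
    exact tendsto_pow_atTop_nhds_zero_of_lt_one (by norm_num) (by norm_num)
  rw [Real.rpow_zero, one_mul] at hlim
  exact ge_of_tendsto' hlim fun n => hle n t ht w

theorem smul_asymptotic (g : SL d 𝕜) {c c' : Ray d 𝕜} (h : Asymptotic c c') :
    Asymptotic (g • c) (g • c') := by
  obtain ⟨C, hC, hb⟩ := h
  exact ⟨C, hC, fun t ht => (rdist_smul_le g _ _).trans (hb t ht)⟩

theorem Ray.velocity_zero_eq_of_basePoint {c c' : Ray d 𝕜} (h0 : c.toFun 0 = basePoint d 𝕜)
    (h0' : c'.toFun 0 = basePoint d 𝕜) (h : Asymptotic c c') :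
    velocity c.toFun 0 = velocity c'.toFun 0 := by
  have heq : ∀ t, 0 ≤ t → (c.toFun t).1 = (c'.toFun t).1 := fun t ht =>
    eq_of_qform_eq (c.toFun t).posDef.1 (c'.toFun t).posDef.1 fun w =>
      le_antisymm (Ray.qform_le h0 h0' h ht w)
        (Ray.qform_le h0' h0 ((raySetoid d 𝕜).symm h) ht w)
  ext i j
  -- The rays are known to agree only for `t ≥ 0`, so the velocities are compared as one-sided
  -- derivatives.
  have h1 := (c.smooth.hasMDerivAt infty_ne_zero 0 i j).hasDerivWithinAt (s := Set.Ici 0)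
  have h2 := (c'.smooth.hasMDerivAt infty_ne_zero 0 i j).hasDerivWithinAt (s := Set.Ici 0)
  have h3 := h2.congr_of_mem (f₁ := fun s => (c.toFun s).1 i j)
    (fun t ht => by rw [heq t ht]) Set.self_mem_Ici
  exact (uniqueDiffOn_Ici (0 : ℝ) 0 Set.self_mem_Ici).eq_deriv _ h1 h3

theorem Ray.smul_toFun (g : SL d 𝕜) (c : Ray d 𝕜) (t : ℝ) : (g • c).toFun t = g • c.toFun t := rfl

theorem Ray.velocity_smul (g : SL d 𝕜) (c : Ray d 𝕜) (t : ℝ) :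
    velocity (g • c).toFun t = g.1 * velocity c.toFun t * g.1ᴴ :=
  SLSym.velocity_smul infty_ne_zero c.smooth g t

/-- Asymptotic rays from the same point have the same initial velocity. -/
theorem Ray.velocity_zero_eq (hd : 2 ≤ d) {c c' : Ray d 𝕜} (h0 : c.toFun 0 = c'.toFun 0)
    (h : Asymptotic c c') : velocity c.toFun 0 = velocity c'.toFun 0 := by
  obtain ⟨g, hg, -⟩ := exists_smul_basePoint_eq hd (c.toFun 0) (e1_ne_zero 𝕜 hd)
  have e : g⁻¹ • c.toFun 0 = basePoint d 𝕜 := by rw [← hg, inv_smul_smul]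
  have key := Ray.velocity_zero_eq_of_basePoint (c := g⁻¹ • c) (c' := g⁻¹ • c') e
    (by rw [Ray.smul_toFun, ← h0, e]) (smul_asymptotic _ h)
  rw [Ray.velocity_smul, Ray.velocity_smul] at key
  have u := (SL.isUnit_det g⁻¹)
  have u' := (SL.isUnit_det_conjTranspose g⁻¹)
  have k2 := congrArg (fun A => (g⁻¹).1⁻¹ * A * ((g⁻¹).1ᴴ)⁻¹) key
  simpa only [Matrix.mul_assoc, Matrix.nonsing_inv_mul_cancel_left _ _ u,
    Matrix.mul_nonsing_inv _ u', mul_one] using k2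

/-- The ray `c` itself shows that the choice in `direction` is not vacuous, and
`Ray.velocity_zero_eq` shows that every admissible choice gives the same vector. -/
theorem direction_eq (hd : 2 ≤ d) (c : Ray d 𝕜) :
    direction (c.toFun 0) c.endpoint = velocity c.toFun 0 := by
  have h := Classical.epsilon_spec (p := fun v => ∃ c' : Ray d 𝕜, c'.toFun 0 = c.toFun 0 ∧
    c'.endpoint = c.endpoint ∧ velocity c'.toFun 0 = v) ⟨_, c, rfl, rfl, rfl⟩
  obtain ⟨c', h1, h2, h3⟩ := h
  rw [direction, ← h3]
  exact Ray.velocity_zero_eq hd h1 (Quotient.exact h2)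

/-! ### The rays from a point to the ideal points of lines and hyperplanes -/

/-- Since `q = hh†`, the matrix `h` is an isometry from the standard inner product to `q⁻¹`. -/
theorem star_mulVec_dotProduct_inv_mulVec {q : X d 𝕜} {h : SL d 𝕜} (hq : h • basePoint d 𝕜 = q)
    (u v : Fin d → 𝕜) : star (h.1 *ᵥ u) ⬝ᵥ q.1⁻¹ *ᵥ (h.1 *ᵥ v) = star u ⬝ᵥ v := by
  rw [← hq, smul_val_inv, basePoint, inv_one, mul_one, Matrix.mulVec_mulVec, Matrix.mul_assoc,
    Matrix.nonsing_inv_mul _ (SL.isUnit_det h), mul_one, Matrix.star_mulVec,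
    Matrix.dotProduct_mulVec, Matrix.vecMul_vecMul,
    Matrix.mul_nonsing_inv _ (SL.isUnit_det_conjTranspose h), Matrix.vecMul_one]

theorem inv_val_mulVec_mulVec (g : SL d 𝕜) (v : Fin d → 𝕜) : (g⁻¹).1 *ᵥ (g.1 *ᵥ v) = v := by
  rw [Matrix.mulVec_mulVec, ← Matrix.SpecialLinearGroup.coe_mul, inv_mul_cancel,
    Matrix.SpecialLinearGroup.coe_one, Matrix.one_mulVec]

theorem mulVec_e1_ne_zero (hd : 2 ≤ d) (h : SL d 𝕜) : h.1 *ᵥ e1 𝕜 hd ≠ 0 := by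
  intro h0
  have := inv_val_mulVec_mulVec h (e1 𝕜 hd)
  rw [h0, Matrix.mulVec_zero] at this
  exact e1_ne_zero 𝕜 hd this.symm

theorem endpoint_smul_diagRay_eq (hd : 0 < d) (a : Fin d → ℝ) (h0 : ∑ i, a i = 0)
    (h1 : 2 * ∑ i, a i ^ 2 = 1) (g h : SL d 𝕜)
    (hp : ∀ i j, (g⁻¹ * h).1 i j ≠ 0 → a j ≤ a i) :
    (h • diagRay 𝕜 a h0 h1).endpoint = g • (diagRay 𝕜 a h0 h1).endpoint := by
  have e : g • (g⁻¹ * h) • diagRay 𝕜 a h0 h1 = h • diagRay 𝕜 a h0 h1 := by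
    refine Ray.ext (funext fun t => ?_)
    simp only [Ray.smul_toFun]
    rw [smul_smul, mul_inv_cancel_left]
  rw [← e]
  exact Quotient.sound ((raySetoid d 𝕜).symm
    (smul_asymptotic g (asymptotic_smul_diagRay hd a h0 h1 _ hp)))

theorem zDiag_le (hd : 2 ≤ d) {i j : Fin d} (h : j.val = 0 → i.val = 0) :
    zDiag d j ≤ zDiag d i := by
  have h2 : (2 : ℝ) ≤ d := by exact_mod_cast hd
  unfold zDiag
  gcongr
  split_ifs with hj hi hi
  · exact le_rfl
  · exact absurd (h hj) hi
  · linarith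
  · exact le_rfl

/-- If `g` is the chosen element, `g⁻¹h` fixes the line of `e₁`, so its first column vanishes below
the top entry. This is the block triangular shape that fixes the endpoint of `c_Z`. -/
theorem endpoint_smul_rayZ (hd : 2 ≤ d) {v : Fin d → 𝕜} (hv : v ≠ 0) {h : SL d 𝕜} {c : 𝕜}
    (hc : h.1 *ᵥ e1 𝕜 hd = c • v) :
    (h • rayZ 𝕜 hd).endpoint = linePoint hd (Projectivization.mk 𝕜 v hv) := by
  have hg := (exists_smul_line hd (Projectivization.mk 𝕜 v hv)).choose_spec
  rw [linePoint]
  set g := (exists_smul_line hd (Projectivization.mk 𝕜 v hv)).choose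
  rw [line1, Projectivization.smul_mk, Projectivization.mk_eq_mk_iff] at hg
  obtain ⟨b, hb⟩ := hg
  have hb' : (b : 𝕜) • v = g.1 *ᵥ e1 𝕜 hd := hb
  refine endpoint_smul_diagRay_eq (by omega) _ _ _ g h fun i j hij => ?_
  refine zDiag_le hd fun hj => ?_
  have hj' : j = ⟨0, by omega⟩ := Fin.ext hj
  have hv' : v = ((b⁻¹ : 𝕜ˣ) : 𝕜) • g.1 *ᵥ e1 𝕜 hd := by
    rw [← hb', smul_smul, Units.inv_mul, one_smul]
  have hcol : (g⁻¹ * h).1 *ᵥ e1 𝕜 hd = (c * ((b⁻¹ : 𝕜ˣ) : 𝕜)) • e1 𝕜 hd := by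
    rw [Matrix.SpecialLinearGroup.coe_mul, ← Matrix.mulVec_mulVec, hc, hv', smul_smul,
      Matrix.mulVec_smul, inv_val_mulVec_mulVec]
  by_contra hi
  have hi' : i ≠ ⟨0, by omega⟩ := fun h => hi (congrArg Fin.val h)
  have := congrFun hcol i
  rw [e1, Matrix.mulVec_single_one, Matrix.col_apply, ← hj'] at this
  rw [this] at hij
  simp [hj', hi'] at hij

/-- Dually, `g⁻¹h` preserves the span of `e₂, …, e_d`, so its first row vanishes after the first
entry, as the reversed order of the entries of `-Z` requires. -/
theorem endpoint_smul_rayNegZ (hd : 2 ≤ d) (τ : ℙ 𝕜 (Module.Dual 𝕜 (Fin d → 𝕜))) {h : SL d 𝕜}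
    (hh : ∀ j : Fin d, j.val ≠ 0 → h.1 *ᵥ Pi.single j 1 ∈ hyperplane τ) :
    (h • rayNegZ 𝕜 hd).endpoint = hyperplanePoint hd τ := by
  have hg := (exists_map_hyperplane hd τ).choose_spec
  rw [hyperplanePoint]
  set g := (exists_map_hyperplane hd τ).choose
  refine endpoint_smul_diagRay_eq (by omega) _ _ _ g h fun i j hij => ?_
  refine neg_le_neg (zDiag_le hd fun hi => ?_)
  by_contra hj
  have hm := hh j hj
  rw [← hg] at hm
  obtain ⟨u, hu, hu'⟩ := hm
  rw [Matrix.toLin'_apply] at hu'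
  have hcol : (g⁻¹ * h).1 *ᵥ Pi.single j 1 = u := by
    rw [Matrix.SpecialLinearGroup.coe_mul, ← Matrix.mulVec_mulVec, ← hu', inv_val_mulVec_mulVec]
  have h0 := (mem_hyperplane1 hd u).1 hu
  rw [← hcol, Matrix.mulVec_single_one, Matrix.col_apply] at h0
  have hi' : i = ⟨0, by omega⟩ := Fin.ext hi
  exact hij (hi' ▸ h0)

theorem velocity_diagRay_zero (a : Fin d → ℝ) (h0 : ∑ i, a i = 0) (h1 : 2 * ∑ i, a i ^ 2 = 1) :
    velocity (diagRay 𝕜 a h0 h1).toFun 0 = Matrix.diagonal fun i => ((2 * a i : ℝ) : 𝕜) := by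
  have := (hasMDerivAt_diag (𝕜 := 𝕜) (fun i => 2 * a i) 1 0).mderiv
  simp only [Pi.one_apply, one_mul] at this
  simpa only [velocity, diagRay_toFun, expDiag_smul_basePoint, mul_zero, Real.exp_zero, mul_one]
    using this

theorem smul_diagRay_zero {q : X d 𝕜} {h : SL d 𝕜} (hq : h • basePoint d 𝕜 = q) (a : Fin d → ℝ)
    (h0 : ∑ i, a i = 0) (h1 : 2 * ∑ i, a i ^ 2 = 1) : (h • diagRay 𝕜 a h0 h1).toFun 0 = q := by
  rw [Ray.smul_toFun, ← hq, diagRay_toFun]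
  congr 1
  exact X.ext ((expDiag_smul_basePoint a h0 0).trans (by simp [basePoint]))

/-- Because `√(2d(d-1)) Z = d e₁e₁† - 1`, the initial velocity depends on `h` only through `q` and
the vector `h e₁`. -/
theorem mul_diagonal_zDiag_mul (hd : 2 ≤ d) {q : X d 𝕜} {h : SL d 𝕜}
    (hq : h • basePoint d 𝕜 = q) :
    h.1 * (Matrix.diagonal fun i => ((2 * zDiag d i : ℝ) : 𝕜)) * h.1ᴴ =
      (2 / Real.sqrt (2 * d * (d - 1))) • ((d : ℝ) •
        Matrix.vecMulVec (h.1 *ᵥ e1 𝕜 hd) (star (h.1 *ᵥ e1 𝕜 hd)) - q.1) := by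
  have e : (Matrix.diagonal fun i => ((2 * zDiag d i : ℝ) : 𝕜)) =
      (2 / Real.sqrt (2 * d * (d - 1))) • ((d : ℝ) •
        Matrix.vecMulVec (e1 𝕜 hd) (star (e1 𝕜 hd)) - (1 : Mat d 𝕜)) := by
    ext i j
    simp only [Matrix.diagonal_apply, Matrix.smul_apply, Matrix.sub_apply, Matrix.vecMulVec_apply,
      Matrix.one_apply, e1, Pi.star_apply, Pi.single_apply, zDiag, RCLike.real_smul_eq_coe_mul]
    by_cases hij : i = j
    · subst hij
      by_cases hi : i.val = 0
      · have hi' : i = ⟨0, by omega⟩ := Fin.ext hi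
        simp [hi']
        ring
      · have hi' : i ≠ ⟨0, by omega⟩ := fun h => hi (congrArg Fin.val h)
        simp [hi, hi']
        ring
    · by_cases hi : i = ⟨0, by omega⟩
      · have hj : j ≠ ⟨0, by omega⟩ := fun hj => hij (hi.trans hj.symm)
        simp [hij, hj]
      · simp [hij, hi]
  rw [e, ← hq, smul_val, basePoint, mul_one]
  simp only [Matrix.mul_smul, Matrix.smul_mul, mul_sub, sub_mul, mul_one, Matrix.mul_vecMulVec,
    Matrix.vecMulVec_mul, Matrix.star_mulVec]

/-! ### The angle -/

theorem metric_sub_left (p : X d 𝕜) (U V W : Mat d 𝕜) :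
    metric p (U - V) W = metric p U W - metric p V W := by
  simp only [metric, mul_sub, sub_mul, Matrix.trace_sub, map_sub]

theorem metric_real_smul_left (p : X d 𝕜) (r : ℝ) (V W : Mat d 𝕜) :
    metric p (r • V) W = r * metric p V W := by
  simp only [metric, Matrix.mul_smul, Matrix.smul_mul, Matrix.trace_smul, RCLike.smul_re]
  ring

theorem metric_self_left (p : X d 𝕜) (W : Mat d 𝕜) :
    metric p p.1 W = 1 / 2 * RCLike.re (p.1⁻¹ * W).trace := by
  rw [metric, Matrix.nonsing_inv_mul _ p.isUnit_det, one_mul]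

theorem metric_vecMulVec (p : X d 𝕜) (x y : Fin d → 𝕜) :
    metric p (Matrix.vecMulVec y (star y)) (Matrix.vecMulVec x (star x)) =
      1 / 2 * ‖star y ⬝ᵥ p.1⁻¹ *ᵥ x‖ ^ 2 := by
  have h : star x ⬝ᵥ p.1⁻¹ *ᵥ y = star (star y ⬝ᵥ p.1⁻¹ *ᵥ x) := by
    rw [Matrix.star_dotProduct, Matrix.star_mulVec, p.posDef.1.inv.eq,
      ← Matrix.dotProduct_mulVec]
  rw [metric, Matrix.mul_assoc, Matrix.mul_vecMulVec, Matrix.mul_vecMulVec,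
    Matrix.vecMulVec_mul_vecMulVec, Matrix.trace_vecMulVec, dotProduct_smul,
    dotProduct_comm _ (star x), h, smul_eq_mul, RCLike.star_def, RCLike.mul_conj]
  norm_cast

/-- Bilinear expansion from `⟨q, q⟩ = d/2`, `⟨q, xx†⟩ = ⟨q, yy†⟩ = ½` and `⟨yy†, xx†⟩ = ½
|y†q⁻¹x|²`. -/
theorem metric_directions {q : X d 𝕜} {x y : Fin d → 𝕜} (hx : star x ⬝ᵥ q.1⁻¹ *ᵥ x = 1)
    (hy : star y ⬝ᵥ q.1⁻¹ *ᵥ y = 1) (b r : ℝ) :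
    metric q (-(b • (r • Matrix.vecMulVec y (star y) - q.1)))
      (b • (r • Matrix.vecMulVec x (star x) - q.1)) =
      -(b ^ 2 / 2) * (r ^ 2 * ‖star y ⬝ᵥ q.1⁻¹ *ᵥ x‖ ^ 2 - 2 * r + d) := by
  have hqq : metric q q.1 q.1 = 1 / 2 * d := by
    rw [metric_self_left, Matrix.nonsing_inv_mul _ q.isUnit_det]; simp
  have hqx : ∀ {z : Fin d → 𝕜}, star z ⬝ᵥ q.1⁻¹ *ᵥ z = 1 →
      metric q q.1 (Matrix.vecMulVec z (star z)) = 1 / 2 := fun hz => by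
    rw [metric_self_left, qform_eq_trace, hz]; simp
  rw [← neg_smul, metric_real_smul_left, metric_comm, metric_real_smul_left, metric_sub_left,
    metric_real_smul_left, metric_comm, metric_sub_left, metric_real_smul_left,
    metric_comm _ q.1 (_ - _), metric_sub_left, metric_real_smul_left, metric_vecMulVec, hqq, hqx hx,
    metric_comm _ _ q.1, hqx hy]
  ring

theorem exists_dotProduct_eq (f : Module.Dual 𝕜 (Fin d → 𝕜)) :
    ∃ w : Fin d → 𝕜, ∀ x, f x = star w ⬝ᵥ x := by
  refine ⟨star fun i => f (Pi.single i 1), fun x => ?_⟩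
  rw [star_star]
  conv_lhs => rw [← Finset.univ_sum_single x]
  rw [map_sum, dotProduct]
  refine Finset.sum_congr rfl fun i _ => ?_
  have : (Pi.single i (x i) : Fin d → 𝕜) = x i • Pi.single i 1 := by
    rw [← Pi.single_smul]; simp
  rw [this, map_smul, smul_eq_mul, mul_comm]

theorem hyperplane_mk {f : Module.Dual 𝕜 (Fin d → 𝕜)} (hf : f ≠ 0) :
    hyperplane (Projectivization.mk 𝕜 f hf) = LinearMap.ker f := by
  ext x
  rw [hyperplane, Submodule.mem_dualCoannihilator, Projectivization.submodule_mk, LinearMap.mem_ker]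
  refine ⟨fun h => h f (Submodule.mem_span_singleton_self f), fun h φ hφ => ?_⟩
  obtain ⟨c, rfl⟩ := Submodule.mem_span_singleton.1 hφ
  simp [h]

theorem transverse_mk_iff {v : Fin d → 𝕜} (hv : v ≠ 0) {f : Module.Dual 𝕜 (Fin d → 𝕜)}
    (hf : f ≠ 0) :
    Transverse (Projectivization.mk 𝕜 v hv) (Projectivization.mk 𝕜 f hf) ↔ f v ≠ 0 := by
  rw [Transverse, hyperplane_mk, Projectivization.submodule_mk]
  constructor
  · intro h h0
    rw [sup_eq_right.2 ((Submodule.span_singleton_le_iff_mem _ _).2 h0), LinearMap.ker_eq_top] at h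
    exact hf h
  · intro h
    refine eq_top_iff.2 fun x _ => Submodule.mem_sup.2
      ⟨(f x / f v) • v, Submodule.smul_mem _ _ (Submodule.mem_span_singleton_self v),
        x - (f x / f v) • v, ?_, add_sub_cancel _ _⟩
    simp [h]

/-- Unit speed removes the norms, and Cauchy–Schwarz puts the inner product in `[-1, 1]`, where
`cos` undoes `arccos`. -/
theorem cos_angle_eq (hd : 2 ≤ d) {q : X d 𝕜} (c c' : Ray d 𝕜) (h : c.toFun 0 = q)
    (h' : c'.toFun 0 = q) : Real.cos (angle q c.endpoint c'.endpoint) =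
      metric q (velocity c.toFun 0) (velocity c'.toFun 0) := by
  have d1 : direction q c.endpoint = velocity c.toFun 0 := h ▸ direction_eq hd c
  have d2 : direction q c'.endpoint = velocity c'.toFun 0 := h' ▸ direction_eq hd c'
  have n1 : metric q (velocity c.toFun 0) (velocity c.toFun 0) = 1 := h ▸ c.unit_speed 0
  have n2 : metric q (velocity c'.toFun 0) (velocity c'.toFun 0) = 1 := h' ▸ c'.unit_speed 0
  have hle := metric_sq_le q (velocity_isHermitian infty_ne_zero c.smooth 0)
    (velocity_isHermitian infty_ne_zero c'.smooth 0)
  rw [n1, n2, mul_one] at hle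
  have := abs_le.1 ((sq_le_one_iff_abs_le_one _).1 hle)
  rw [angle, d1, d2, tnorm, tnorm, n1, n2, Real.sqrt_one, mul_one, div_one,
    Real.cos_arccos this.1 this.2]

/-- The cosine of the angle between a hyperplane and a line, in terms of the unit vectors `x` on the
line and `y` normal to the hyperplane for the inner product `q⁻¹`. -/
theorem exists_cos_angle_eq (hd : 2 ≤ d) (q : X d 𝕜) {v : Fin d → 𝕜} (hv : v ≠ 0)
    {f : Module.Dual 𝕜 (Fin d → 𝕜)} (hf : f ≠ 0) : ∃ b : 𝕜, b ≠ 0 ∧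
      Real.cos (angle q (hyperplanePoint hd (Projectivization.mk 𝕜 f hf))
        (linePoint hd (Projectivization.mk 𝕜 v hv))) = (1 - d * ‖b * f v‖ ^ 2) / (d - 1) := by
  obtain ⟨w, hw⟩ := exists_dotProduct_eq f
  -- The vector `qw` is normal to the hyperplane for `q⁻¹`, as `(qw)†q⁻¹x = w†x = f x`.
  have hqw : q.1 *ᵥ w ≠ 0 := by
    intro h
    have h2 : w = 0 := by
      rw [← Matrix.one_mulVec w, ← Matrix.nonsing_inv_mul _ q.isUnit_det, ← Matrix.mulVec_mulVec, h,
        Matrix.mulVec_zero]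
    exact hf (LinearMap.ext fun x => by simp [hw, h2])
  obtain ⟨g, hg, a, ha⟩ := exists_smul_basePoint_eq hd q hv
  obtain ⟨h, hh, c, hc⟩ := exists_smul_basePoint_eq hd q hqw
  have ha0 : a ≠ 0 := by
    rintro rfl; exact mulVec_e1_ne_zero hd g (by rw [ha, zero_smul])
  have hc0 : c ≠ 0 := by
    rintro rfl; exact mulVec_e1_ne_zero hd h (by rw [hc, zero_smul])
  have hf' : ∀ x, star (h.1 *ᵥ e1 𝕜 hd) ⬝ᵥ q.1⁻¹ *ᵥ x = star c * f x := by
    intro x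
    rw [hc, star_smul, smul_dotProduct, Matrix.star_mulVec, q.posDef.1.eq, Matrix.dotProduct_mulVec,
      Matrix.vecMul_vecMul, Matrix.mul_nonsing_inv _ q.isUnit_det, Matrix.vecMul_one, hw, smul_eq_mul]
  -- As `h` is an isometry, `h eⱼ` is orthogonal to the normal `h e₁`, hence lies in the kernel of
  -- `f`.
  have hhyp : ∀ j : Fin d, j.val ≠ 0 →
      h.1 *ᵥ Pi.single j 1 ∈ hyperplane (Projectivization.mk 𝕜 f hf) := by
    intro j hj
    have hj' : j ≠ ⟨0, by omega⟩ := fun h => hj (congrArg Fin.val h)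
    have := hf' (h.1 *ᵥ Pi.single j 1)
    rw [star_mulVec_dotProduct_inv_mulVec hh] at this
    rw [hyperplane_mk, LinearMap.mem_ker]
    have h0 : star (e1 𝕜 hd) ⬝ᵥ Pi.single j 1 = 0 := by
      simp [e1, hj']
    rw [h0] at this
    exact (mul_eq_zero.1 this.symm).resolve_left (star_ne_zero.2 hc0)
  have he : star (e1 𝕜 hd) ⬝ᵥ e1 𝕜 hd = 1 := by simp [e1]
  -- Here `x = g e₁ = a v` and `y = h e₁ = c q w`, so `y†q⁻¹x` is `star c * a * f v`.
  refine ⟨star c * a, mul_ne_zero (star_ne_zero.2 hc0) ha0, ?_⟩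
  rw [← endpoint_smul_rayZ hd hv ha, ← endpoint_smul_rayNegZ hd _ hhyp,
    rayZ, rayNegZ,
    cos_angle_eq hd _ _ (smul_diagRay_zero hh _ _ _) (smul_diagRay_zero hg _ _ _),
    Ray.velocity_smul, Ray.velocity_smul, velocity_diagRay_zero,
    velocity_diagRay_zero, mul_diagonal_zDiag_mul hd hg]
  have hneg : (Matrix.diagonal fun i => ((2 * -zDiag d i : ℝ) : 𝕜)) =
      -(Matrix.diagonal fun i => ((2 * zDiag d i : ℝ) : 𝕜)) := by
    rw [Matrix.diagonal_neg]
    congr 1; funext i; simp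
  rw [hneg, mul_neg, neg_mul, mul_diagonal_zDiag_mul hd hh,
    metric_directions ((star_mulVec_dotProduct_inv_mulVec hg _ _).trans he)
      ((star_mulVec_dotProduct_inv_mulVec hh _ _).trans he), hf', ha, map_smul, smul_eq_mul,
    ← mul_assoc]
  have h2 : (2 : ℝ) ≤ d := by exact_mod_cast hd
  have h3 : (0 : ℝ) < d - 1 := by linarith
  have h4 : (0 : ℝ) ≤ 2 * d * (d - 1) := by positivity
  rw [div_pow, Real.sq_sqrt h4]
  field_simp
  ring

theorem transverse_iff_cos_angle_lt (hd : 2 ≤ d) (τp : ℙ 𝕜 (Fin d → 𝕜))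
    (τm : ℙ 𝕜 (Module.Dual 𝕜 (Fin d → 𝕜))) (q : X d 𝕜) :
    Transverse τp τm ↔
      Real.cos (angle q (hyperplanePoint hd τm) (linePoint hd τp)) < 1 / ((d : ℝ) - 1) := by
  induction τp using Projectivization.ind with
  | h v hv =>
  induction τm using Projectivization.ind with
  | h f hf =>
  obtain ⟨b, hb, hcos⟩ := exists_cos_angle_eq hd q hv hf
  have h2 : (2 : ℝ) ≤ d := by exact_mod_cast hd
  -- With the common denominator gone, the inequality says `0 < d ‖b f(v)‖²`, and `b ≠ 0`.
  rw [hcos, transverse_mk_iff, div_lt_div_iff_of_pos_right (by linarith), sub_lt_self_iff]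
  constructor
  · intro h
    have := norm_pos_iff.2 (mul_ne_zero hb h)
    positivity
  · rintro h h0
    simp [h0] at h

end SLSym

end

theorem mainTheorem5 {𝕜 : Type*} [RCLike 𝕜] {d : ℕ} (hd : 2 ≤ d)
    (τp : ℙ 𝕜 (Fin d → 𝕜)) (τm : ℙ 𝕜 (Module.Dual 𝕜 (Fin d → 𝕜))) :
    (∀ q : SLSym.X d 𝕜, SLSym.Transverse τp τm ↔
      Real.cos (SLSym.angle q (SLSym.hyperplanePoint hd τm) (SLSym.linePoint hd τp)) <
        1 / ((d : ℝ) - 1)) ∧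
    ((∃ q : SLSym.X d 𝕜,
      Real.cos (SLSym.angle q (SLSym.hyperplanePoint hd τm) (SLSym.linePoint hd τp)) <
        1 / ((d : ℝ) - 1)) ↔
      ∀ q : SLSym.X d 𝕜,
        Real.cos (SLSym.angle q (SLSym.hyperplanePoint hd τm) (SLSym.linePoint hd τp)) <
          1 / ((d : ℝ) - 1)) := by
  have h := SLSym.transverse_iff_cos_angle_lt hd τp τm
  -- Transversality does not involve the point, so it transfers the inequality from `q` to `p`; the
  -- converse only needs `X` to be nonempty.
  exact ⟨h, fun ⟨q, hq⟩ p => (h p).1 ((h q).2 hq), fun hq => ⟨SLSym.basePoint d 𝕜, hq _⟩⟩
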